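/- Let $X$ be a measurable space, $Y\subseteq\mathbb{R}$, $\rho$ a probability measure on $Z=X\times Y$, $\mathcal{F}$ a real separable Hilbert space, $\Phi:X\to\mathcal{F}$ a measurable feature map, and $V:\mathbb{R}\times\mathbb{R}\to[0,\infty)$ a measurable loss such that $V(y,\cdot)$ is convex for every $y\in Y$, with left-hand derivative $V'_-(y,\cdot)$. For $w\in\mathcal{F}$ put $\mathcal{E}(w)=\int_Z V(y,\langle w,\Phi(x)\rangle)\,d\rho(x,y)$. Assume that $$\|\Phi(x)\|\le\kappa,\qquad V(y,0)\le |V|_0,\qquad |V'_-(y,a)|\le a_0\qquad\text{for all } x\in X,\ y\in Y,\ a\in\mathbb{R},$$ and that for some $\beta\in(0,1]$ and $c_\beta>0$ $$\inf_{w\in\mathcal{F}}\Big\{\mathcal{E}(w)+\tfrac{\lambda}{2}\|w\|^2\Big\}-\inf_{w\in\mathcal{F}}\mathcal{E}(w)\le c_\beta\lambda^\beta\qquad\text{for all }\lambda>0 .$$ Let $m\ge 1$, let $\mathbf{z}=(x_i,y_i)_{i=1}^m$ be drawn independently according to $\rho$, and let $j_1,j_2,\dots$ be independent and uniformly distributed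 on $\{1,\dots,m\}$, independent of $\mathbf{z}$. For a non-increasing sequence of step-sizes $\eta_t>0$ $(t\ge1)$ let $w_1=0$ and $$w_{t+1}=w_t-\eta_t V'_-\big(y_{j_t},\langle w_t,\Phi(x_{j_t})\rangle\big)\Phi(x_{j_t}),\qquad \overline{w}_t=\frac{\sum_{k=1}^t\eta_k w_k}{\sum_{k=1}^t\eta_k},\qquad t\ge 1 .$$ Then for all integers $t\ge1$ the following expectations over $\mathbf{z}$ and $(j_k)$ are finite and $$\mathbb{E}\big[\mathcal{E}(\overline{w}_t)-\inf_{w\in\mathcal{F}}\mathcal{E}(w)\big]\le C\left(\sqrt{\frac{\sum_{k=1}^t\eta_k}{m}}+\frac{\sum_{k=1}^t\eta_k^2}{\sum_{k=1}^t\eta_k}+\Big(\frac{1}{\sum_{k=1}^t\eta_k}\Big)^{\beta}\right),$$ $$\mathbb{E}\big[\mathcal{E}(w_t)-\inf_{w\in\mathcal{F}}\mathcal{E}(w)\big]\le C\left(\sqrt{\frac{\sum_{k=1}^t\eta_k}{m}}\;\sum_{k=1}^{t-1}\frac{\eta_k}{\eta_t(t-k)}+\sum_{k=1}^{t-1}\frac{\eta_k^2}{\eta_t(t-k)}+\eta_t+\frac{\big(\sum_{k=1}^t\eta_k\big)^{1-\beta}}{\eta_t\,t}\right),$$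 where the constant $C>0$ depends only on $\kappa$, $a_0$, $|V|_0$, $c_\beta$ and an upper bound on $\eta_1$ (and not on $m$, $t$, $\beta$, $\rho$, $X$, $Y$, $V$, $\Phi$, $\mathcal{F}$ or otherwise on the step-sizes). -/

import Mathlib

open MeasureTheory

noncomputable section

namespace SGM

/-- The left-hand derivative of a function of one real variable. -/
def leftDeriv (f : ℝ → ℝ) (a : ℝ) : ℝ := derivWithin f (Set.Iio a) a

/-- The expected risk `∫ V (y, ⟪w, Φ x⟫) dρ (x, y)` of the linear function with parameter `w`. -/
def risk {X F : Type*} [MeasurableSpace X] [NormedAddCommGroup F] [InnerProductSpace ℝ F]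
    {Y : Set ℝ} (ρ : Measure (X × Y)) (V : ℝ → ℝ → ℝ) (Φ : X → F) (w : F) : ℝ :=
  ∫ z, V (z.2 : ℝ) (inner ℝ w (Φ z.1)) ∂ρ

/-- The infimum of the expected risk over the hypothesis space. -/
def infRisk {X F : Type*} [MeasurableSpace X] [NormedAddCommGroup F] [InnerProductSpace ℝ F]
    {Y : Set ℝ} (ρ : Measure (X × Y)) (V : ℝ → ℝ → ℝ) (Φ : X → F) : ℝ :=
  ⨅ w : F, risk ρ V Φ w

/-- The approximation error `𝒟 lam`. -/
def approxError {X F : Type*} [MeasurableSpace X] [NormedAddCommGroup F] [InnerProductSpace ℝ F]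
    {Y : Set ℝ} (ρ : Measure (X × Y)) (V : ℝ → ℝ → ℝ) (Φ : X → F) (lam : ℝ) : ℝ :=
  (⨅ w : F, (risk ρ V Φ w + lam / 2 * ‖w‖ ^ 2)) - infRisk ρ V Φ

/-- The stochastic gradient iterates on the sample `z` along the index sequence `j`, numbered
from `1`: `w₁ = 0` and `wₜ₊₁ = wₜ - ηₜ V'₋(y_{jₜ}, ⟪wₜ, Φ (x_{jₜ})⟫) Φ (x_{jₜ})`.
The value at `0` is not used. -/
def iterate {X F : Type*} [NormedAddCommGroup F] [InnerProductSpace ℝ F] {Y : Set ℝ}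
    (V : ℝ → ℝ → ℝ) (Φ : X → F) (η : ℕ → ℝ) {m : ℕ} (z : Fin m → X × Y) (j : ℕ → Fin m) : ℕ → F
  | 0 => 0
  | 1 => 0
  | t + 2 =>
      let w := iterate V Φ η z j (t + 1)
      let x := (z (j (t + 1))).1
      let y : ℝ := (z (j (t + 1))).2
      w - (η (t + 1) * leftDeriv (V y) (inner ℝ w (Φ x))) • Φ x

/-- The averaged iterates `(∑ k ∈ [t], ηₖ wₖ) / (∑ k ∈ [t], ηₖ)`. -/
def avgIterate {X F : Type*} [NormedAddCommGroup F] [InnerProductSpace ℝ F] {Y : Set ℝ}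
    (V : ℝ → ℝ → ℝ) (Φ : X → F) (η : ℕ → ℝ) {m : ℕ} (z : Fin m → X × Y) (j : ℕ → Fin m)
    (t : ℕ) : F :=
  (∑ k ∈ Finset.Icc 1 t, η k)⁻¹ • ∑ k ∈ Finset.Icc 1 t, η k • iterate V Φ η z j k

/-- The joint law of the sample `z` (`m` independent draws from `ρ`) and the index sequence `j`
(independent and uniform on the `m` sample points, independent of the sample). -/
def jointLaw {X : Type*} [MeasurableSpace X] {Y : Set ℝ} (ρ : Measure (X × Y)) (m : ℕ) [NeZero m] :
    Measure ((Fin m → X × Y) × (ℕ → Fin m)) :=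
  (Measure.pi fun _ : Fin m => ρ).prod
    (Measure.infinitePi fun _ : ℕ => (PMF.uniformOfFintype (Fin m)).toMeasure)

end SGM

end

/-! The excess risk splits into a sample error (risk minus empirical risk of the iterates), an
optimization error (regret of the iterates for the empirical risk) and the approximation error.

Comparing with the zero parameter in the basic descent inequality confines every iterate up to time
`t`, for every sample and index sequence, to a ball of radius of order `√(∑ ηₖ)`
(`norm_iterate_le`). Symmetrization and contraction bound the expected deviation of risk from
empirical risk uniformly on a ball of radius `R` by a multiple of `R / √m`
(`exists_uniform_deviation`), so the sample error is of order `√(∑ ηₖ / m)`.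

For the optimization error, `wₖ` does not involve `jₖ`, so the loss at the selected point has the
same expectation as the empirical risk (`integral_loss_selected`). Summing the descent inequality
then bounds the weighted regret against any comparator that ignores the indices still to come
(`sum_integral_empRisk_sub_le`).

A fixed comparator, the choice `lam = 1 / ∑ ηₖ` and convexity give the bound for the average. For
the last iterate the comparators are the earlier iterates `wₛ`: these window estimates are combined
by telescoping averages over the last `k` iterates (`le_average_add_of_sum_sub_le`), which is where
the weights `1 / (t - k)` come from. -/

noncomputable section

namespace SGM

/-! ### Rademacher signs and the mean norm of a signed sum -/

section Signs

variable {I : Type*}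

/-- The real value `±1` of the `i`-th entry of a vector of signs. -/
def signVal (σ : I → ℤˣ) (i : I) : ℝ := ((σ i : ℤ) : ℝ)

lemma signVal_eq (σ : I → ℤˣ) (i : I) : signVal σ i = 1 ∨ signVal σ i = -1 := by
  unfold signVal
  rcases Int.units_eq_one_or (σ i) with h | h <;> simp [h]

lemma abs_signVal (σ : I → ℤˣ) (i : I) : |signVal σ i| = 1 := by
  rcases signVal_eq σ i with h | h <;> simp [h]

lemma signVal_one (i : I) : signVal (1 : I → ℤˣ) i = 1 := by simp [signVal]

variable [DecidableEq I]

/-- Changing the sign of the `i`-th entry, as a permutation of the vectors of signs. -/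
def flipSign (i : I) : Equiv.Perm (I → ℤˣ) := Equiv.mulRight (Pi.mulSingle i (-1))

lemma signVal_flipSign_same (σ : I → ℤˣ) (i : I) :
    signVal (flipSign i σ) i = -signVal σ i := by
  simp [signVal, flipSign]

lemma signVal_flipSign_of_ne (σ : I → ℤˣ) {i j : I} (h : j ≠ i) :
    signVal (flipSign i σ) j = signVal σ j := by
  simp [signVal, flipSign, Pi.mulSingle_eq_of_ne h]

variable [Fintype I]

/-- Flipping the `i`-th sign permutes the sign vectors and negates each summand. -/
lemma sum_signVal_mul_signVal {i j : I} (h : i ≠ j) :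
    ∑ σ : I → ℤˣ, signVal σ i * signVal σ j = 0 := by
  have := Equiv.sum_comp (flipSign i) fun σ : I → ℤˣ => signVal σ i * signVal σ j
  simp only [signVal_flipSign_same, signVal_flipSign_of_ne _ h.symm, neg_mul,
    Finset.sum_neg_distrib] at this
  linarith

variable {F : Type*} [NormedAddCommGroup F] [InnerProductSpace ℝ F]

lemma sum_norm_sq_signed_sum (v : I → F) :
    ∑ σ : I → ℤˣ, ‖∑ i, signVal σ i • v i‖ ^ 2
      = Fintype.card (I → ℤˣ) * ∑ i, ‖v i‖ ^ 2 := by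
  have h (σ : I → ℤˣ) : ‖∑ i, signVal σ i • v i‖ ^ 2
      = ∑ i, ∑ j, (signVal σ i * signVal σ j) * inner ℝ (v i) (v j) := by
    rw [← real_inner_self_eq_norm_sq, sum_inner]
    refine Finset.sum_congr rfl fun i _ => ?_
    rw [inner_sum]
    refine Finset.sum_congr rfl fun j _ => ?_
    rw [real_inner_smul_left, real_inner_smul_right, mul_assoc]
  simp_rw [h]
  rw [Finset.sum_comm, Finset.mul_sum]
  refine Finset.sum_congr rfl fun i _ => ?_
  rw [Finset.sum_comm, Finset.sum_eq_single i]
  · rw [← Finset.sum_mul, real_inner_self_eq_norm_sq]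
    congr 1
    have (σ : I → ℤˣ) : signVal σ i * signVal σ i = 1 := by
      rcases signVal_eq σ i with h | h <;> simp [h]
    simp [this]
  · intro j _ hj
    rw [← Finset.sum_mul, sum_signVal_mul_signVal hj.symm, zero_mul]
  · simp

/-- Cauchy–Schwarz over the sign vectors reduces this to second moments, where orthogonality of the
signs has removed the cross terms. -/
lemma sum_norm_signed_sum_le {v : I → F} {κ : ℝ} (hκ : 0 ≤ κ) (hv : ∀ i, ‖v i‖ ≤ κ) :
    ∑ σ : I → ℤˣ, ‖∑ i, signVal σ i • v i‖
      ≤ Fintype.card (I → ℤˣ) * (κ * √(Fintype.card I)) := by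
  have h1 := sq_sum_le_card_mul_sum_sq (s := (Finset.univ : Finset (I → ℤˣ)))
    (f := fun σ => ‖∑ i, signVal σ i • v i‖)
  rw [sum_norm_sq_signed_sum, Finset.card_univ] at h1
  have h2 : ∑ i, ‖v i‖ ^ 2 ≤ Fintype.card I * κ ^ 2 := by
    calc ∑ i, ‖v i‖ ^ 2 ≤ ∑ _i : I, κ ^ 2 := Finset.sum_le_sum fun i _ => by
          gcongr; exact hv i
      _ = Fintype.card I * κ ^ 2 := by simp
  refine abs_le_of_sq_le_sq' ?_ (by positivity) |>.2
  calc _ ≤ _ := h1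
    _ ≤ (Fintype.card (I → ℤˣ) : ℝ) * (Fintype.card (I → ℤˣ) * (Fintype.card I * κ ^ 2)) := by
        gcongr
    _ = _ := by
        rw [mul_pow, mul_pow, Real.sq_sqrt (by positivity)]; ring

end Signs

/-! ### The contraction principle -/

section Contraction

/-- For a pair `(n, k)` the left side is at most `g n + g k + |b n - b k|`. According to the sign of
`b n - b k`, this is a value of the right side at `(n, k)` or at `(k, n)`. -/
lemma iSup_add_iSup_sub_le {ι : Type*} [Nonempty ι] {g a b : ι → ℝ}
    (hab : ∀ n k, |a n - a k| ≤ |b n - b k|)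
    (h1 : BddAbove (Set.range fun n => g n + b n)) (h2 : BddAbove (Set.range fun n => g n - b n)) :
    (⨆ n, (g n + a n)) + (⨆ n, (g n - a n)) ≤ (⨆ n, (g n + b n)) + ⨆ n, (g n - b n) := by
  have key (n k : ι) : (g n + a n) + (g k - a k) ≤ (⨆ n, (g n + b n)) + ⨆ n, (g n - b n) := by
    have e1 := le_ciSup h1 n
    have e2 := le_ciSup h1 k
    have e3 := le_ciSup h2 n
    have e4 := le_ciSup h2 k
    have h := (le_abs_self _).trans (hab n k)
    rcases abs_cases (b n - b k) with ⟨h', _⟩ | ⟨h', _⟩ <;> linarith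
  have h3 (n : ι) : (⨆ k, (g k - a k)) ≤ (⨆ n, (g n + b n)) + (⨆ n, (g n - b n)) - (g n + a n) :=
    ciSup_le fun k => by linarith [key n k]
  have h4 : (⨆ n, (g n + a n)) ≤
      (⨆ n, (g n + b n)) + (⨆ n, (g n - b n)) - ⨆ k, (g k - a k) :=
    ciSup_le fun n => by linarith [h3 n]
  linarith

variable {I : Type*} [Fintype I] {ι : Type*}

lemma bddAbove_range_signed_sum (σ : I → ℤˣ) {b : ι → I → ℝ} {M : ℝ} (hM : ∀ n i, |b n i| ≤ M) :
    BddAbove (Set.range fun n => ∑ i, signVal σ i * b n i) := by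
  refine ⟨∑ _i : I, M, ?_⟩
  rintro _ ⟨n, rfl⟩
  refine Finset.sum_le_sum fun i _ => (le_abs_self _).trans ?_
  rw [abs_mul, abs_signVal, one_mul]
  exact hM n i

variable [DecidableEq I] [Nonempty ι]

/-- Pairing each sign vector with its flip at `i` reduces the claim to `iSup_add_iSup_sub_le`, with
`g` the sum over the other coordinates. -/
lemma sum_iSup_signed_sum_le_of_eq_off {a b : ι → I → ℝ} {M : ℝ} (i : I)
    (hab : ∀ n k, |a n i - a k i| ≤ |b n i - b k i|) (heq : ∀ j ≠ i, ∀ n, a n j = b n j)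
    (hM : ∀ n i, |b n i| ≤ M) :
    ∑ σ : I → ℤˣ, ⨆ n, ∑ j, signVal σ j * a n j ≤ ∑ σ : I → ℤˣ, ⨆ n, ∑ j, signVal σ j * b n j := by
  have split (c : ι → I → ℝ) (σ : I → ℤˣ) (n : ι) : ∑ j, signVal σ j * c n j
      = (∑ j ∈ Finset.univ.erase i, signVal σ j * c n j) + signVal σ i * c n i :=
    (Finset.sum_erase_add _ _ (Finset.mem_univ i)).symm
  have split' (c : ι → I → ℝ) (σ : I → ℤˣ) (n : ι) : ∑ j, signVal (flipSign i σ) j * c n j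
      = (∑ j ∈ Finset.univ.erase i, signVal σ j * c n j) - signVal σ i * c n i := by
    rw [split, signVal_flipSign_same, neg_mul, ← sub_eq_add_neg]
    congr 1
    exact Finset.sum_congr rfl fun j hj => by
      rw [signVal_flipSign_of_ne _ (Finset.ne_of_mem_erase hj)]
  have off (σ : I → ℤˣ) (n : ι) : ∑ j ∈ Finset.univ.erase i, signVal σ j * a n j
      = ∑ j ∈ Finset.univ.erase i, signVal σ j * b n j :=
    Finset.sum_congr rfl fun j hj => by rw [heq j (Finset.ne_of_mem_erase hj)]
  have key (σ : I → ℤˣ) : (⨆ n, ∑ j, signVal σ j * a n j)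
        + (⨆ n, ∑ j, signVal (flipSign i σ) j * a n j)
      ≤ (⨆ n, ∑ j, signVal σ j * b n j) + ⨆ n, ∑ j, signVal (flipSign i σ) j * b n j := by
    have h1 := bddAbove_range_signed_sum σ hM
    have h2 := bddAbove_range_signed_sum (flipSign i σ) hM
    simp_rw [split b] at h1
    simp_rw [split' b] at h2
    simp_rw [split' a, split' b, split a, split b, off]
    refine iSup_add_iSup_sub_le (fun n k => ?_) h1 h2
    rw [← mul_sub, ← mul_sub, abs_mul, abs_mul, abs_signVal, one_mul, one_mul]
    exact hab n k
  have hsum := Finset.sum_le_sum fun σ (_ : σ ∈ (Finset.univ : Finset (I → ℤˣ))) => key σ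
  rw [Finset.sum_add_distrib, Finset.sum_add_distrib,
    Equiv.sum_comp (flipSign i) fun σ => ⨆ n, ∑ j, signVal σ j * a n j,
    Equiv.sum_comp (flipSign i) fun σ => ⨆ n, ∑ j, signVal σ j * b n j] at hsum
  linarith

/-- The contraction principle for Rademacher averages. -/
theorem sum_iSup_signed_sum_le {a b : ι → I → ℝ} {M : ℝ}
    (hab : ∀ i n k, |a n i - a k i| ≤ |b n i - b k i|)
    (ha : ∀ n i, |a n i| ≤ M) (hb : ∀ n i, |b n i| ≤ M) :
    ∑ σ : I → ℤˣ, ⨆ n, ∑ j, signVal σ j * a n j ≤ ∑ σ : I → ℤˣ, ⨆ n, ∑ j, signVal σ j * b n j := by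
  -- The coordinates are exchanged one at a time; the hybrid families stay bounded by the common
  -- `M`.
  have key (s : Finset I) : ∑ σ : I → ℤˣ, ⨆ n, ∑ j, signVal σ j * a n j
      ≤ ∑ σ : I → ℤˣ, ⨆ n, ∑ j, signVal σ j * (if j ∈ s then b n j else a n j) := by
    induction s using Finset.induction_on with
    | empty => simp
    | insert i s hi ih =>
      refine ih.trans (sum_iSup_signed_sum_le_of_eq_off (M := M) i (fun n k => ?_)
        (fun j hj n => ?_) (fun n j => ?_))
      · simpa [hi] using hab i n k
      · simp [hj]
      · split_ifs
        exacts [hb n j, ha n j]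
  simpa using key Finset.univ

end Contraction

/-! ### Rademacher averages of Lipschitz losses on a ball -/

section Deviation

variable {F : Type*} [NormedAddCommGroup F] [InnerProductSpace ℝ F]

/-- Contraction replaces the losses by `L` times linear functionals; for these Cauchy–Schwarz bounds
the supremum by the norm of a signed sum of the `v i`. -/
theorem sum_iSup_signed_loss_le {I : Type*} [Fintype I] [DecidableEq I] {ι : Type*} [Nonempty ι]
    {u : ι → F} {R : ℝ} (hu : ∀ n, ‖u n‖ ≤ R) {v : I → F} {κ : ℝ} (hv : ∀ i, ‖v i‖ ≤ κ)
    {a : ι → I → ℝ} {M : ℝ} (ha : ∀ n i, |a n i| ≤ M) {L : ℝ} (hL : 0 ≤ L) (hκ : 0 ≤ κ)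
    (hlip : ∀ i n k, |a n i - a k i| ≤ L * |inner ℝ (u n - u k) (v i)|) :
    ∑ σ : I → ℤˣ, ⨆ n, ∑ i, signVal σ i * a n i
      ≤ Fintype.card (I → ℤˣ) * (L * R * κ * √(Fintype.card I)) := by
  obtain ⟨n₀⟩ := ‹Nonempty ι›
  have hR : 0 ≤ R := (norm_nonneg _).trans (hu n₀)
  have : Nonempty ι := ⟨n₀⟩
  have hb (n : ι) (i : I) : |L * inner ℝ (u n) (v i)| ≤ L * (R * κ) := by
    rw [abs_mul, abs_of_nonneg hL]
    refine mul_le_mul_of_nonneg_left ((abs_real_inner_le_norm _ _).trans ?_) hL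
    exact mul_le_mul (hu n) (hv i) (norm_nonneg _) hR
  refine (sum_iSup_signed_sum_le (b := fun n i => L * inner ℝ (u n) (v i))
    (M := max M (L * (R * κ))) (fun i n k => ?_)
    (fun n i => (ha n i).trans (le_max_left _ _))
    (fun n i => (hb n i).trans (le_max_right _ _))).trans ?_
  · rw [← mul_sub, ← inner_sub_left, abs_mul, abs_of_nonneg hL]
    exact hlip i n k
  · calc _ ≤ ∑ σ : I → ℤˣ, L * R * ‖∑ i, signVal σ i • v i‖ := by
          refine Finset.sum_le_sum fun σ _ => ciSup_le fun n => ?_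
          have : ∑ i, signVal σ i * (L * inner ℝ (u n) (v i))
              = L * inner ℝ (u n) (∑ i, signVal σ i • v i) := by
            rw [inner_sum, Finset.mul_sum]
            refine Finset.sum_congr rfl fun i _ => ?_
            rw [real_inner_smul_right]; ring
          rw [this, mul_assoc]
          refine mul_le_mul_of_nonneg_left ((real_inner_le_norm _ _).trans ?_) hL
          exact mul_le_mul_of_nonneg_right (hu n) (norm_nonneg _)
      _ = L * R * ∑ σ : I → ℤˣ, ‖∑ i, signVal σ i • v i‖ := by rw [Finset.mul_sum]
      _ ≤ L * R * (Fintype.card (I → ℤˣ) * (κ * √(Fintype.card I))) :=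
          mul_le_mul_of_nonneg_left (sum_norm_signed_sum_le hκ hv) (by positivity)
      _ = _ := by ring

end Deviation

lemma integral_comp_measurePreserving {α β : Type*} [MeasurableSpace α] [MeasurableSpace β]
    {μ : Measure α} {ν : Measure β} {g : α → β} (hg : MeasurePreserving g μ ν) {f : β → ℝ}
    (hf : Measurable f) : ∫ x, f (g x) ∂μ = ∫ y, f y ∂ν := by
  rw [← hg.map_eq, integral_map hg.measurable.aemeasurable hf.aestronglyMeasurable]

lemma abs_ciSup_le_of_forall_abs_le {ι : Type*} [Nonempty ι] {g : ι → ℝ} {B : ℝ}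
    (h : ∀ n, |g n| ≤ B) : |⨆ n, g n| ≤ B := by
  obtain ⟨n₀⟩ := ‹Nonempty ι›
  have : Nonempty ι := ⟨n₀⟩
  refine abs_le.2 ⟨?_, ciSup_le fun n => (abs_le.1 (h n)).2⟩
  exact le_ciSup_of_le ⟨B, by rintro _ ⟨n, rfl⟩; exact (abs_le.1 (h n)).2⟩ n₀ (abs_le.1 (h n₀)).1

/-! ### Symmetrization and the uniform deviation bound -/

section Symmetrization

variable {Z : Type*} [MeasurableSpace Z] {I : Type*} [Fintype I]

/-- A sign `-1` at `i` amounts to swapping the `i`-th points of the two independent samples, which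
preserves their joint law. -/
lemma integral_signed_eq (ρ : Measure Z) [IsProbabilityMeasure ρ] {f : ℕ → Z → ℝ}
    (hf : ∀ n, Measurable (f n)) (σ : I → ℤˣ) :
    ∫ p : (I → Z) × (I → Z), (⨆ n, ∑ i, signVal σ i * (f n (p.2 i) - f n (p.1 i)))
        ∂((Measure.pi fun _ => ρ).prod (Measure.pi fun _ => ρ))
      = ∫ p : (I → Z) × (I → Z), (⨆ n, ∑ i, (f n (p.2 i) - f n (p.1 i)))
        ∂((Measure.pi fun _ => ρ).prod (Measure.pi fun _ => ρ)) := by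
  classical
  have he := measurePreserving_arrowProdEquivProdArrow Z Z I (fun _ => ρ) (fun _ => ρ)
  have hS : MeasurePreserving
      (fun (ζ : I → Z × Z) i => (if σ i = 1 then id else Prod.swap : Z × Z → Z × Z) (ζ i))
      (Measure.pi fun _ : I => ρ.prod ρ) (Measure.pi fun _ : I => ρ.prod ρ) := by
    refine measurePreserving_pi _ _ fun i => ?_
    split_ifs
    · exact MeasurePreserving.id _
    · exact Measure.measurePreserving_swap
  have hm (c : I → ℝ) : Measurable fun p : (I → Z) × (I → Z) =>
      ⨆ n, ∑ i, c i * (f n (p.2 i) - f n (p.1 i)) :=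
    Measurable.iSup fun n => by
      have := hf n
      fun_prop
  have hm1 := hm 1
  simp only [Pi.one_apply, one_mul] at hm1
  rw [← integral_comp_measurePreserving he (hm _),
    ← integral_comp_measurePreserving he hm1]
  refine Eq.trans ?_ (integral_comp_measurePreserving hS (hm1.comp he.measurable))
  refine integral_congr_ae (Filter.Eventually.of_forall fun ζ => ?_)
  refine congrArg iSup (funext fun n => Finset.sum_congr rfl fun i _ => ?_)
  rcases Int.units_eq_one_or (σ i) with h | h <;>
    simp [h, signVal, MeasurableEquiv.arrowProdEquivProdArrow, Equiv.arrowProdEquivProdArrow]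

variable {F : Type*} [NormedAddCommGroup F] [InnerProductSpace ℝ F]

/-- A second, ghost sample replaces the expectations; averaging over signs then leaves one
Rademacher average per sample, hence the factor `2`. The index set is `ℕ` so that the supremum is
measurable. -/
lemma iSup_signed_loss_le (ρ : Measure Z) [IsProbabilityMeasure ρ] {f : ℕ → Z → ℝ}
    (hf : ∀ n, Measurable (f n)) {M : ℝ} (hM : ∀ n z, |f n z| ≤ M) {Φ : Z → F} {κ : ℝ}
    (hκ : 0 ≤ κ) (hΦ : ∀ z, ‖Φ z‖ ≤ κ) {u : ℕ → F} {R : ℝ} (hu : ∀ n, ‖u n‖ ≤ R) {L : ℝ}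
    (hL : 0 ≤ L) (hlip : ∀ z n k, |f n z - f k z| ≤ L * |inner ℝ (u n - u k) (Φ z)|) :
    Integrable (fun z : I → Z => ⨆ n, ∑ i, (∫ x, f n x ∂ρ - f n (z i)))
        (Measure.pi fun _ => ρ) ∧
      ∫ z : I → Z, (⨆ n, ∑ i, (∫ x, f n x ∂ρ - f n (z i))) ∂(Measure.pi fun _ => ρ)
        ≤ 2 * (L * R * κ * √(Fintype.card I)) := by
  classical
  set μ : Measure (I → Z) := Measure.pi fun _ => ρ with hμ
  have hdiff (n : ℕ) (x y : Z) : |f n x - f n y| ≤ 2 * M :=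
    (abs_sub _ _).trans (by linarith [hM n x, hM n y])
  have hsum {a : I → ℝ} {B : ℝ} (ha : ∀ i, |a i| ≤ B) : |∑ i, a i| ≤ Fintype.card I * B := by
    refine (Finset.abs_sum_le_sum_abs _ _).trans ((Finset.sum_le_sum fun i _ => ha i).trans ?_)
    simp
  have hint (n : ℕ) : |∫ x, f n x ∂ρ| ≤ M := by
    have := norm_integral_le_of_norm_le_const (μ := ρ) (f := f n)
      (Filter.Eventually.of_forall fun z => hM n z)
    simpa using this
  have hDbound (z : I → Z) (n : ℕ) : |∑ i, (∫ x, f n x ∂ρ - f n (z i))|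
      ≤ Fintype.card I * (2 * M) := by
    refine hsum fun i => (abs_sub _ _).trans ?_
    linarith [hint n, hM n (z i)]
  have hDm : Measurable fun z : I → Z => ⨆ n, ∑ i, (∫ x, f n x ∂ρ - f n (z i)) :=
    Measurable.iSup fun n => by
      have := hf n
      fun_prop
  have hDint : Integrable (fun z : I → Z => ⨆ n, ∑ i, (∫ x, f n x ∂ρ - f n (z i))) μ :=
    Integrable.of_bound hDm.aestronglyMeasurable (Fintype.card I * (2 * M))
      (Filter.Eventually.of_forall fun z => abs_ciSup_le_of_forall_abs_le (hDbound z))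
  refine ⟨hDint, ?_⟩
  have hTbound (c : I → ℤˣ) (p : (I → Z) × (I → Z)) (n : ℕ) :
      |∑ i, signVal c i * (f n (p.2 i) - f n (p.1 i))| ≤ Fintype.card I * (2 * M) :=
    hsum fun i => by
      rw [abs_mul, abs_signVal, one_mul]
      exact hdiff _ _ _
  have hTm (c : I → ℤˣ) : Measurable fun p : (I → Z) × (I → Z) =>
      ⨆ n, ∑ i, signVal c i * (f n (p.2 i) - f n (p.1 i)) :=
    Measurable.iSup fun n => by
      have := hf n
      fun_prop
  have hTint (c : I → ℤˣ) : Integrable (fun p : (I → Z) × (I → Z) =>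
      ⨆ n, ∑ i, signVal c i * (f n (p.2 i) - f n (p.1 i))) (μ.prod μ) :=
    Integrable.of_bound (hTm c).aestronglyMeasurable (Fintype.card I * (2 * M))
      (Filter.Eventually.of_forall fun z => abs_ciSup_le_of_forall_abs_le (hTbound c z))
  have hT1int := hTint 1
  simp only [signVal_one, one_mul] at hT1int
  have hT1bound (p : (I → Z) × (I → Z)) (n : ℕ) :
      |∑ i, (f n (p.2 i) - f n (p.1 i))| ≤ Fintype.card I * (2 * M) := by
    simpa only [signVal_one, one_mul] using hTbound 1 p n
  have hsym : ∫ z : I → Z, (⨆ n, ∑ i, (∫ x, f n x ∂ρ - f n (z i))) ∂μ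
      ≤ ∫ p : (I → Z) × (I → Z), (⨆ n, ∑ i, (f n (p.2 i) - f n (p.1 i))) ∂(μ.prod μ) := by
    -- Jensen: integrating over the ghost sample inside the supremum gives at most the integral of
    -- the supremum.
    rw [integral_prod _ hT1int]
    refine integral_mono_ae hDint hT1int.integral_prod_left ?_
    filter_upwards [hT1int.prod_right_ae] with z hz
    refine ciSup_le fun n => ?_
    have hfint (i : I) : Integrable (fun z' : I → Z => f n (z' i)) μ :=
      Integrable.of_bound ((hf n).comp (measurable_pi_apply i)).aestronglyMeasurable M
        (Filter.Eventually.of_forall fun z => hM n _)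
    have hsub (i : I) : Integrable (fun z' : I → Z => f n (z' i) - f n (z i)) μ :=
      (hfint i).sub (integrable_const _)
    have : ∑ i, (∫ x, f n x ∂ρ - f n (z i)) = ∫ z' : I → Z, ∑ i, (f n (z' i) - f n (z i)) ∂μ := by
      rw [integral_finsetSum _ fun i _ => hsub i]
      refine Finset.sum_congr rfl fun i _ => ?_
      rw [integral_sub (hfint i) (integrable_const _), integral_const, probReal_univ, one_smul,
        hμ, integral_comp_measurePreserving (measurePreserving_eval (fun _ : I => ρ) i) (hf n)]
    rw [this]
    refine integral_mono (integrable_finsetSum _ fun i _ => hsub i) hz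
      fun z' => ?_
    exact le_ciSup (f := fun n => ∑ i, (f n (z' i) - f n (z i)))
      ⟨_, by rintro _ ⟨k, rfl⟩; exact (abs_le.1 (hT1bound (z, z') k)).2⟩ n
  have hN : (0 : ℝ) < Fintype.card (I → ℤˣ) := by exact_mod_cast Fintype.card_pos
  have hpt (p : (I → Z) × (I → Z)) :
      ∑ σ : I → ℤˣ, (⨆ n, ∑ i, signVal σ i * (f n (p.2 i) - f n (p.1 i)))
        ≤ Fintype.card (I → ℤˣ) * (2 * (L * R * κ * √(Fintype.card I))) := by
    have h1 := sum_iSup_signed_loss_le (I := I) (ι := ℕ) hu (v := fun i => Φ (p.2 i))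
      (fun i => hΦ _) (a := fun n i => f n (p.2 i)) (M := M) (fun n i => hM _ _) hL hκ
      (fun i n k => hlip _ _ _)
    have h2 := sum_iSup_signed_loss_le (I := I) (ι := ℕ) hu (v := fun i => Φ (p.1 i))
      (fun i => hΦ _) (a := fun n i => -f n (p.1 i)) (M := M) (fun n i => by
        rw [abs_neg]; exact hM _ _) hL hκ
      (fun i n k => by rw [neg_sub_neg, abs_sub_comm]; exact hlip _ _ _)
    refine le_trans ?_ ((add_le_add h1 h2).trans_eq (by ring))
    rw [← Finset.sum_add_distrib]
    refine Finset.sum_le_sum fun σ _ => ciSup_le fun n => ?_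
    have e1 := le_ciSup (bddAbove_range_signed_sum σ (b := fun n i => f n (p.2 i)) (M := M)
      fun n i => hM _ _) n
    have e2 := le_ciSup (bddAbove_range_signed_sum σ (b := fun n i => -f n (p.1 i)) (M := M)
      fun n i => by rw [abs_neg]; exact hM _ _) n
    refine le_trans (le_of_eq ?_) (add_le_add e1 e2)
    rw [← Finset.sum_add_distrib]
    exact Finset.sum_congr rfl fun i _ => by ring
  refine hsym.trans (le_of_mul_le_mul_left ?_ hN)
  calc _ = ∑ σ : I → ℤˣ, ∫ p : (I → Z) × (I → Z),
          (⨆ n, ∑ i, signVal σ i * (f n (p.2 i) - f n (p.1 i))) ∂(μ.prod μ) := by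
        simp_rw [hμ, integral_signed_eq ρ hf]
        simp
    _ = ∫ p : (I → Z) × (I → Z), ∑ σ : I → ℤˣ,
          (⨆ n, ∑ i, signVal σ i * (f n (p.2 i) - f n (p.1 i))) ∂(μ.prod μ) :=
        (integral_finsetSum _ fun σ _ => hTint σ).symm
    _ ≤ ∫ _p : (I → Z) × (I → Z),
          Fintype.card (I → ℤˣ) * (2 * (L * R * κ * √(Fintype.card I))) ∂(μ.prod μ) :=
        integral_mono (integrable_finsetSum _ fun σ _ => hTint σ) (integrable_const _) hpt
    _ = _ := by simp

/-- A uniform deviation bound over a ball of a separable Hilbert space, for losses which are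
Lipschitz functions of `⟪w, Φ z⟫`. -/
theorem exists_uniform_deviation [CompleteSpace F] [TopologicalSpace.SeparableSpace F]
    (ρ : Measure Z) [IsProbabilityMeasure ρ] {l : F → Z → ℝ}
    (hl : ∀ w, Measurable (l w)) {B : ℝ} (hB : ∀ z, |l 0 z| ≤ B) {Φ : Z → F} {κ : ℝ}
    (hκ : 0 ≤ κ) (hΦ : ∀ z, ‖Φ z‖ ≤ κ) {R : ℝ} (hR : 0 ≤ R) {L : ℝ}
    (hL : 0 ≤ L) (hlip : ∀ z w w', |l w z - l w' z| ≤ L * |inner ℝ (w - w') (Φ z)|)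
    (m : ℕ) (hm : 0 < m) :
    ∃ D : (Fin m → Z) → ℝ, Integrable D (Measure.pi fun _ => ρ) ∧
      (∀ z w, ‖w‖ ≤ R → ∫ x, l w x ∂ρ - (m : ℝ)⁻¹ * ∑ i, l w (z i) ≤ D z) ∧
      ∫ z, D z ∂(Measure.pi fun _ => ρ) ≤ 2 * (L * R * κ) / √m := by
  have hlip' (z : Z) (w w' : F) : |l w z - l w' z| ≤ L * κ * ‖w - w'‖ := by
    refine (hlip z w w').trans ?_
    rw [mul_assoc]
    refine mul_le_mul_of_nonneg_left ((abs_real_inner_le_norm _ _).trans ?_) hL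
    rw [mul_comm]
    exact mul_le_mul_of_nonneg_right (hΦ z) (norm_nonneg _)
  have hbound (z : Z) (w : F) : |l w z| ≤ B + L * κ * ‖w‖ := by
    have h1 := hlip' z w 0
    rw [sub_zero] at h1
    have h2 := abs_sub_abs_le_abs_sub (l w z) (l 0 z)
    linarith [hB z]
  have : Nonempty (Metric.closedBall (0 : F) R) := ⟨⟨0, by simpa using hR⟩⟩
  have : SecondCountableTopology F := UniformSpace.secondCountable_of_separable F
  -- A countable dense family suffices: both the risk and each loss are Lipschitz in `w`, so the
  -- bound extends to the whole ball by continuity.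
  let u : ℕ → Metric.closedBall (0 : F) R := TopologicalSpace.denseSeq _
  have hu (n : ℕ) : ‖(u n : F)‖ ≤ R := mem_closedBall_zero_iff.1 (u n).2
  have hM (n : ℕ) (z : Z) : |l (u n) z| ≤ B + L * κ * R :=
    (hbound z _).trans (by
      have := hu n
      gcongr)
  obtain ⟨h1, h2⟩ := iSup_signed_loss_le (I := Fin m) ρ (f := fun n => l (u n))
    (fun n => hl _) hM hκ hΦ hu hL (fun z n k => hlip z _ _)
  have hmR : (0 : ℝ) < m := by exact_mod_cast hm
  refine ⟨fun z => (m : ℝ)⁻¹ * ⨆ n, ∑ i, (∫ x, l (u n) x ∂ρ - l (u n) (z i)),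
    h1.const_mul _, fun z w hw => ?_, ?_⟩
  · have hcont (z : Z) : Continuous fun w => l w z := by
      have hlw : LipschitzWith (Real.toNNReal (L * κ)) fun w => l w z :=
        LipschitzWith.of_dist_le_mul fun w w' => by
          rw [Real.dist_eq, dist_eq_norm, Real.coe_toNNReal _ (by positivity)]
          exact hlip' z w w'
      exact hlw.continuous
    have hli (w : F) : Integrable (l w) ρ :=
      Integrable.of_bound (hl w).aestronglyMeasurable _
        (Filter.Eventually.of_forall fun z => hbound z w)
    have hrc : Continuous fun w => ∫ x, l w x ∂ρ := by
      have hlw : LipschitzWith (Real.toNNReal (L * κ)) fun w => ∫ x, l w x ∂ρ :=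
        LipschitzWith.of_dist_le_mul fun w w' => by
          rw [Real.dist_eq, dist_eq_norm, Real.coe_toNNReal _ (by positivity),
            ← integral_sub (hli w) (hli w')]
          have := norm_integral_le_of_norm_le_const (μ := ρ) (f := fun x => l w x - l w' x)
            (Filter.Eventually.of_forall fun z => hlip' z w w')
          simpa using this
      exact hlw.continuous
    have hdense : DenseRange u := TopologicalSpace.denseRange_denseSeq _
    have key : ∀ w : Metric.closedBall (0 : F) R, ∑ i, (∫ x, l w x ∂ρ - l w (z i))
        ≤ ⨆ n, ∑ i, (∫ x, l (u n) x ∂ρ - l (u n) (z i)) := by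
      intro w
      refine hdense.induction_on (p := fun w => ∑ i, (∫ x, l w x ∂ρ - l w (z i))
        ≤ ⨆ n, ∑ i, (∫ x, l (u n) x ∂ρ - l (u n) (z i))) w ?_ fun n => ?_
      · refine isClosed_le (continuous_finsetSum _ fun i _ => ?_) continuous_const
        exact (hrc.comp continuous_subtype_val).sub ((hcont _).comp continuous_subtype_val)
      · refine le_ciSup (f := fun n => ∑ i, (∫ x, l (u n) x ∂ρ - l (u n) (z i)))
          ⟨∑ _i : Fin m, 2 * (B + L * κ * R), ?_⟩ n
        rintro _ ⟨k, rfl⟩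
        refine Finset.sum_le_sum fun i _ => ?_
        have e1 := norm_integral_le_of_norm_le_const (μ := ρ) (f := l (u k))
          (Filter.Eventually.of_forall fun z => hM k z)
        rw [probReal_univ, mul_one] at e1
        linarith [(abs_le.1 (hM k (z i))).1, (abs_le.1 e1).2]
    have hk := key ⟨w, by simpa using hw⟩
    refine le_trans (le_of_eq ?_) (mul_le_mul_of_nonneg_left hk (inv_nonneg.2 hmR.le))
    rw [Finset.sum_sub_distrib, mul_sub]
    simp [hmR.ne']
  · rw [integral_const_mul]
    refine (mul_le_mul_of_nonneg_left h2 (inv_nonneg.2 hmR.le)).trans_eq ?_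
    have hs : √(m : ℝ) ≠ 0 := (Real.sqrt_pos.2 hmR).ne'
    have hs2 : √(m : ℝ) * √m = m := Real.mul_self_sqrt hmR.le
    rw [Fintype.card_fin]
    field_simp
    rw [sq, hs2]
    ring

end Symmetrization

/-! ### Left derivatives of convex functions, and telescoping averages -/

/-- The left derivative is a subgradient: it dominates slopes to the left, and is at most the right
derivative, hence at most slopes to the right. -/
lemma add_leftDeriv_mul_le {f : ℝ → ℝ} (hf : ConvexOn ℝ Set.univ f) (a b : ℝ) :
    f a + leftDeriv f a * (b - a) ≤ f b := by
  rcases lt_trichotomy a b with h | rfl | h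
  · have h1 := hf.leftDeriv_le_rightDeriv_of_mem_interior (x := a) (by simp)
    have h2 := hf.le_slope_of_hasDerivWithinAt_Ioi (Set.mem_univ a) (Set.mem_univ b) h
      (hf.hasDerivWithinAt_rightDeriv_of_mem_interior (x := a) (by simp))
    rw [slope_def_field, le_div_iff₀ (sub_pos.2 h)] at h2
    have h3 := mul_le_mul_of_nonneg_right h1 (sub_pos.2 h).le
    unfold leftDeriv
    linarith
  · simp
  · have h2 := hf.slope_le_leftDeriv_of_mem_interior (x := b) (y := a) (Set.mem_univ _)
      (by simp) h
    rw [slope_def_field, div_le_iff₀ (sub_pos.2 h)] at h2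
    unfold leftDeriv
    linarith

/-- A countable sequence of slopes is what makes the left derivative jointly measurable in label and
argument. -/
lemma tendsto_leftDeriv {f : ℝ → ℝ} (hf : ConvexOn ℝ Set.univ f) (a : ℝ) :
    Filter.Tendsto (fun n : ℕ => slope f a (a - 1 / ((n : ℝ) + 1))) Filter.atTop
      (nhds (leftDeriv f a)) := by
  have h := (hasDerivWithinAt_iff_tendsto_slope' Set.self_notMem_Iio).1
    (hf.hasDerivWithinAt_leftDeriv_of_mem_interior (x := a) (by simp))
  refine h.comp (tendsto_nhdsWithin_iff.2 ⟨?_, Filter.Eventually.of_forall fun n => ?_⟩)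
  · simpa using tendsto_const_nhds.sub (tendsto_one_div_add_atTop_nhds_zero_nat (𝕜 := ℝ))
  · have : (0 : ℝ) < 1 / ((n : ℝ) + 1) := by positivity
    simpa using by linarith

/-- Comparison of the first term of a sequence with its average, by telescoping the successive
averages. -/
lemma le_average_add_of_sum_sub_le {A B c : ℕ → ℝ} (hc0 : c 0 = 1)
    (hc : ∀ r, 1 ≤ r → c r = 1 / r) {t : ℕ}
    (h : ∀ k, 1 ≤ k → k < t →
      ∑ r ∈ Finset.range k, (A r - A k) ≤ ∑ r ∈ Finset.range (k + 1), B r)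
    {k : ℕ} (hk : 1 ≤ k) (hkt : k ≤ t) :
    A 0 ≤ (1 / k) * ∑ r ∈ Finset.range k, (A r - B r) + ∑ r ∈ Finset.range k, c r * B r := by
  induction k, hk using Nat.le_induction with
  | base => simp [hc0]
  | succ k hk ih =>
    refine (ih (by omega)).trans ?_
    have hk0 : (0 : ℝ) < k := by exact_mod_cast hk
    have h1 := h k hk (by omega)
    rw [Finset.sum_range_succ, Finset.sum_sub_distrib] at h1
    simp only [Finset.sum_const, Finset.card_range, nsmul_eq_mul] at h1
    rw [Finset.sum_range_succ _ k, Finset.sum_range_succ _ k, hc k hk]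
    have h2 : ∑ r ∈ Finset.range k, (A r - B r) ≤ k * A k + B k := by
      rw [Finset.sum_sub_distrib]; linarith
    set T := ∑ r ∈ Finset.range k, (A r - B r)
    -- The two sides differ by `(k * A k + B k - T) / (k * (k + 1))`, and `h2` says that this
    -- numerator is nonnegative.
    have : 1 / (k : ℝ) * T ≤ 1 / ((k + 1 : ℕ) : ℝ) * (T + (A k - B k)) + 1 / k * B k := by
      push_cast
      rw [← sub_nonneg]
      have : 1 / ((k : ℝ) + 1) * (T + (A k - B k)) + 1 / k * B k - 1 / k * T
          = (k * A k + B k - T) / (k * (k + 1)) := by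
        field_simp; ring
      rw [this]
      exact div_nonneg (by linarith) (by positivity)
    linarith

/-! ### Losses, the recursion and deterministic estimates -/

/-- The standing assumptions on the loss and the feature map. -/
structure BoundedConvexLoss {X F : Type*} [MeasurableSpace X] [NormedAddCommGroup F]
    [MeasurableSpace F] (Y : Set ℝ) (V : ℝ → ℝ → ℝ) (Φ : X → F) (κ a₀ V₀ : ℝ) : Prop where
  measurable_loss : Measurable (Function.uncurry V)
  nonneg : ∀ y a, 0 ≤ V y a
  measurable_feature : Measurable Φ
  norm_le : ∀ x, ‖Φ x‖ ≤ κ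
  convex : ∀ y ∈ Y, ConvexOn ℝ Set.univ (V y)
  loss_zero_le : ∀ y ∈ Y, V y 0 ≤ V₀
  abs_leftDeriv_le : ∀ y ∈ Y, ∀ a, |leftDeriv (V y) a| ≤ a₀
  radius_nonneg : 0 ≤ κ
  slope_nonneg : 0 ≤ a₀
  bound_nonneg : 0 ≤ V₀

/-- The loss of the parameter `w` at the point `z`. -/
def loss {X F : Type*} [NormedAddCommGroup F] [InnerProductSpace ℝ F]
    {Y : Set ℝ} (V : ℝ → ℝ → ℝ) (Φ : X → F) (w : F) (z : X × Y) : ℝ :=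
  V (z.2 : ℝ) (inner ℝ w (Φ z.1))

/-- The empirical risk on the sample `z`. -/
def empRisk {X F : Type*} [NormedAddCommGroup F] [InnerProductSpace ℝ F]
    {Y : Set ℝ} (V : ℝ → ℝ → ℝ) (Φ : X → F) {m : ℕ} (z : Fin m → X × Y) (w : F) : ℝ :=
  (m : ℝ)⁻¹ * ∑ i, loss V Φ w (z i)

lemma BoundedConvexLoss.measurable_leftDeriv {X F : Type*} [MeasurableSpace X]
    [NormedAddCommGroup F] [MeasurableSpace F] {Y : Set ℝ} {V : ℝ → ℝ → ℝ} {Φ : X → F}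
    {κ a₀ V₀ : ℝ} (h : BoundedConvexLoss Y V Φ κ a₀ V₀) :
    Measurable fun q : Y × ℝ => leftDeriv (V q.1) q.2 := by
  refine measurable_of_tendsto_metrizable
    (f := fun (n : ℕ) (q : Y × ℝ) => slope (V q.1) q.2 (q.2 - 1 / ((n : ℝ) + 1))) (fun n => ?_) ?_
  · have hV := h.measurable_loss
    simp only [slope_def_field]
    have h1 : Measurable fun q : Y × ℝ => V q.1 (q.2 - 1 / ((n : ℝ) + 1)) :=
      hV.comp (f := fun q : Y × ℝ => ((q.1 : ℝ), q.2 - 1 / ((n : ℝ) + 1))) (by fun_prop)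
    have h2 : Measurable fun q : Y × ℝ => V q.1 q.2 :=
      hV.comp (f := fun q : Y × ℝ => ((q.1 : ℝ), q.2)) (by fun_prop)
    fun_prop
  · exact tendsto_pi_nhds.2 fun q => tendsto_leftDeriv (h.convex q.1 q.1.2) q.2

section Recursion

variable {X F : Type*} [NormedAddCommGroup F] [InnerProductSpace ℝ F] {Y : Set ℝ}
  {V : ℝ → ℝ → ℝ} {Φ : X → F} {η : ℕ → ℝ} {m : ℕ}

lemma iterate_succ (z : Fin m → X × Y) (j : ℕ → Fin m) {k : ℕ} (hk : 1 ≤ k) :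
    iterate V Φ η z j (k + 1) = iterate V Φ η z j k
      - (η k * leftDeriv (V (z (j k)).2) (inner ℝ (iterate V Φ η z j k) (Φ (z (j k)).1)))
        • Φ (z (j k)).1 := by
  obtain ⟨k, rfl⟩ := Nat.exists_eq_add_of_le' hk
  rfl

/-- The `k`-th iterate reads only the indices before `k`. This is the form in which independence of
`wₖ` and `jₖ` is used. -/
lemma iterate_update (z : Fin m → X × Y) (j : ℕ → Fin m) (i : ℕ) (c : Fin m)
    {k : ℕ} (hk : k ≤ i) :
    iterate V Φ η z (Function.update j i c) k = iterate V Φ η z j k := by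
  induction k with
  | zero => rfl
  | succ k ih =>
    rcases Nat.eq_zero_or_pos k with rfl | hk0
    · rfl
    · rw [iterate_succ z _ hk0, iterate_succ z _ hk0, ih (by omega),
        Function.update_of_ne (by omega)]

end Recursion

section Pointwise

variable {X F : Type*} [MeasurableSpace X] [NormedAddCommGroup F] [InnerProductSpace ℝ F]
  [MeasurableSpace F] {Y : Set ℝ} {V : ℝ → ℝ → ℝ} {Φ : X → F} {κ a₀ V₀ : ℝ}

namespace BoundedConvexLoss

lemma loss_nonneg (h : BoundedConvexLoss Y V Φ κ a₀ V₀) (w : F) (z : X × Y) :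
    0 ≤ loss V Φ w z := h.nonneg _ _

lemma abs_loss_sub_le (h : BoundedConvexLoss Y V Φ κ a₀ V₀) (z : X × Y) (w w' : F) :
    |loss V Φ w z - loss V Φ w' z| ≤ a₀ * |inner ℝ (w - w') (Φ z.1)| := by
  have key (a b : ℝ) : V z.2 a - V z.2 b ≤ a₀ * |a - b| := by
    have h1 := add_leftDeriv_mul_le (h.convex z.2 z.2.2) a b
    have h2 : leftDeriv (V z.2) a * (a - b) ≤ a₀ * |a - b| := by
      refine (le_abs_self _).trans ?_
      rw [abs_mul]
      exact mul_le_mul_of_nonneg_right (h.abs_leftDeriv_le z.2 z.2.2 a) (abs_nonneg _)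
    linarith
  rw [inner_sub_left]
  refine abs_le.2 ⟨?_, key _ _⟩
  have := key (inner ℝ w' (Φ z.1)) (inner ℝ w (Φ z.1))
  rw [abs_sub_comm] at this
  unfold loss
  linarith

lemma abs_loss_le (h : BoundedConvexLoss Y V Φ κ a₀ V₀) (w : F) (z : X × Y) :
    |loss V Φ w z| ≤ V₀ + a₀ * κ * ‖w‖ := by
  have h1 := h.abs_loss_sub_le z w 0
  have h2 : |inner ℝ (w - 0) (Φ z.1)| ≤ κ * ‖w‖ := by
    rw [sub_zero, mul_comm]
    exact (abs_real_inner_le_norm _ _).trans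
      (mul_le_mul_of_nonneg_left (h.norm_le _) (norm_nonneg _))
  have h3 := mul_le_mul_of_nonneg_left h2 h.slope_nonneg
  have h4 : |loss V Φ 0 z| ≤ V₀ := by
    rw [abs_of_nonneg (h.loss_nonneg _ _)]
    simpa [loss] using h.loss_zero_le z.2 z.2.2
  have h5 := abs_sub_abs_le_abs_sub (loss V Φ w z) (loss V Φ 0 z)
  linarith

lemma measurable_loss_uncurry [SecondCountableTopology F] [OpensMeasurableSpace F]
    (h : BoundedConvexLoss Y V Φ κ a₀ V₀) :
    Measurable fun p : F × (X × Y) => loss V Φ p.1 p.2 := by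
  have h1 := h.measurable_feature
  have h2 : Measurable fun p : F × (X × Y) => (inner ℝ p.1 (Φ p.2.1) : ℝ) :=
    measurable_fst.inner (h1.comp (by fun_prop))
  exact h.measurable_loss.comp (f := fun p : F × (X × Y) => ((p.2.2 : ℝ), inner ℝ p.1 (Φ p.2.1)))
    (by fun_prop)

end BoundedConvexLoss

section Iterates

variable {η : ℕ → ℝ} {m : ℕ}

/-- Expand the square: the subgradient inequality controls the cross term, and the step direction
has norm at most `a₀ * κ`. -/
lemma BoundedConvexLoss.norm_iterate_succ_sub_sq_le (h : BoundedConvexLoss Y V Φ κ a₀ V₀)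
    (z : Fin m → X × Y) (j : ℕ → Fin m) {k : ℕ} (hk : 1 ≤ k) (hη : 0 ≤ η k) (v : F) :
    ‖iterate V Φ η z j (k + 1) - v‖ ^ 2 ≤ ‖iterate V Φ η z j k - v‖ ^ 2
      + (a₀ * κ) ^ 2 * η k ^ 2
      + 2 * η k * (loss V Φ v (z (j k)) - loss V Φ (iterate V Φ η z j k) (z (j k))) := by
  rw [iterate_succ z j hk]
  set w := iterate V Φ η z j k
  set x := Φ (z (j k)).1 with hx
  set g := leftDeriv (V (z (j k)).2) (inner ℝ w x) with hg
  have e : w - (η k * g) • x - v = (w - v) - (η k * g) • x := by abel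
  rw [e, norm_sub_sq_real, real_inner_smul_right, inner_sub_left, norm_smul, Real.norm_eq_abs,
    mul_pow, sq_abs]
  have h1 := add_leftDeriv_mul_le (h.convex _ (z (j k)).2.2) (inner ℝ w x) (inner ℝ v x)
  rw [← hg] at h1
  have h2 : g ^ 2 * ‖x‖ ^ 2 ≤ (a₀ * κ) ^ 2 := by
    rw [mul_pow, ← sq_abs g]
    have := h.abs_leftDeriv_le _ (z (j k)).2.2 (inner ℝ w x)
    have := h.norm_le (z (j k)).1
    gcongr
  have h3 := mul_le_mul_of_nonneg_left h2 (sq_nonneg (η k))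
  have h4 : g * (inner ℝ w x - inner ℝ v x)
      ≥ loss V Φ w (z (j k)) - loss V Φ v (z (j k)) := by
    unfold loss
    linarith
  have h5 := mul_le_mul_of_nonneg_left h4 (by linarith : 0 ≤ 2 * η k)
  nlinarith

lemma BoundedConvexLoss.norm_iterate_sub_sq_add_le (h : BoundedConvexLoss Y V Φ κ a₀ V₀)
    (z : Fin m → X × Y) (j : ℕ → Fin m) (hη : ∀ k, 1 ≤ k → 0 < η k) {s n : ℕ} (hs : 1 ≤ s)
    (hn : s ≤ n) (v : F) :
    ‖iterate V Φ η z j n - v‖ ^ 2 + 2 * ∑ k ∈ Finset.Ico s n,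
        η k * (loss V Φ (iterate V Φ η z j k) (z (j k)) - loss V Φ v (z (j k)))
      ≤ ‖iterate V Φ η z j s - v‖ ^ 2 + (a₀ * κ) ^ 2 * ∑ k ∈ Finset.Ico s n, η k ^ 2 := by
  induction n, hn using Nat.le_induction with
  | base => simp
  | succ n hn ih =>
    have := h.norm_iterate_succ_sub_sq_le z j (hs.trans hn) (hη n (hs.trans hn)).le v
    rw [Finset.sum_Ico_succ_top hn, Finset.sum_Ico_succ_top hn]
    nlinarith

/-- With comparator `0`, each step gains at most `2 * V₀ * η i` because losses are nonnegative, plus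
`(a₀ * κ) ^ 2 * η i ^ 2`, where `η i ^ 2 ≤ b * η i`. -/
lemma BoundedConvexLoss.norm_iterate_le (h : BoundedConvexLoss Y V Φ κ a₀ V₀)
    (z : Fin m → X × Y) (j : ℕ → Fin m) (hη : ∀ k, 1 ≤ k → 0 < η k) {b : ℝ}
    (hb : ∀ k, 1 ≤ k → η k ≤ b) {k t : ℕ} (hk : 1 ≤ k) (hkt : k ≤ t) :
    ‖iterate V Φ η z j k‖ ≤ √(((a₀ * κ) ^ 2 * b + 2 * V₀) * ∑ i ∈ Finset.Icc 1 t, η i) := by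
  refine Real.le_sqrt_of_sq_le ?_
  have h1 := h.norm_iterate_sub_sq_add_le z j hη le_rfl hk 0
  have h0 : iterate V Φ η z j 1 = 0 := rfl
  simp only [sub_zero, h0, norm_zero] at h1
  have h2 : ∑ i ∈ Finset.Ico 1 k, η i ^ 2 ≤ ∑ i ∈ Finset.Ico 1 k, b * η i :=
    Finset.sum_le_sum fun i hi => by
      have hi1 := (Finset.mem_Ico.1 hi).1
      rw [sq]
      exact mul_le_mul_of_nonneg_right (hb i hi1) (hη i hi1).le
  have h3 : -(V₀ * ∑ i ∈ Finset.Ico 1 k, η i) ≤ ∑ i ∈ Finset.Ico 1 k,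
      η i * (loss V Φ (iterate V Φ η z j i) (z (j i)) - loss V Φ 0 (z (j i))) := by
    rw [Finset.mul_sum, ← Finset.sum_neg_distrib]
    refine Finset.sum_le_sum fun i hi => ?_
    have e1 := h.loss_nonneg (iterate V Φ η z j i) (z (j i))
    have e2 := (le_abs_self _).trans (h.abs_loss_le 0 (z (j i)))
    rw [norm_zero, mul_zero, add_zero] at e2
    nlinarith [hη i (Finset.mem_Ico.1 hi).1]
  have h4 : ∑ i ∈ Finset.Ico 1 k, η i ≤ ∑ i ∈ Finset.Icc 1 t, η i :=
    Finset.sum_le_sum_of_subset_of_nonneg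
      (fun i hi => Finset.mem_Icc.2 ⟨(Finset.mem_Ico.1 hi).1,
        ((Finset.mem_Ico.1 hi).2.le.trans hkt)⟩)
      fun i hi _ => (hη i (Finset.mem_Icc.1 hi).1).le
  rw [← Finset.mul_sum] at h2
  have hb0 : 0 ≤ b := (hη 1 le_rfl).le.trans (hb 1 le_rfl)
  have h5 := mul_le_mul_of_nonneg_left h2 (sq_nonneg (a₀ * κ))
  have h6 := mul_le_mul_of_nonneg_left h4
    (add_nonneg (mul_nonneg (sq_nonneg (a₀ * κ)) hb0) (mul_nonneg zero_le_two h.bound_nonneg))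
  nlinarith

end Iterates

end Pointwise

/-! ### The joint law and expectations under it -/

instance {X : Type*} [MeasurableSpace X] {Y : Set ℝ} (ρ : Measure (X × Y))
    [IsProbabilityMeasure ρ] (m : ℕ) [NeZero m] : IsProbabilityMeasure (jointLaw ρ m) := by
  unfold jointLaw
  infer_instance

lemma map_equiv_uniform {α : Type*} [Fintype α] [Nonempty α] [MeasurableSpace α]
    [MeasurableSingletonClass α] (e : α ≃ α) :
    (PMF.uniformOfFintype α).toMeasure.map e = (PMF.uniformOfFintype α).toMeasure := by
  classical
  have he : Measurable e := measurable_of_finite _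
  refine Measure.ext_of_singleton fun a => ?_
  have hpre : e ⁻¹' {a} = {e.symm a} := by
    ext b; simp [Equiv.eq_symm_apply]
  rw [Measure.map_apply he (measurableSet_singleton _), hpre,
    PMF.toMeasure_apply_singleton _ _ (measurableSet_singleton _),
    PMF.toMeasure_apply_singleton _ _ (measurableSet_singleton _)]
  simp

/-- Invariance under cyclic shifts of one index takes the place of conditioning on the other
indices. -/
lemma measurePreserving_shift_index {X : Type*} [MeasurableSpace X] {Y : Set ℝ}
    (ρ : Measure (X × Y)) [IsProbabilityMeasure ρ] {m : ℕ} [NeZero m] (k : ℕ) (c : Fin m) :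
    MeasurePreserving (fun p : (Fin m → X × Y) × (ℕ → Fin m) =>
      (p.1, Function.update p.2 k (p.2 k + c))) (jointLaw ρ m) (jointLaw ρ m) := by
  have h : MeasurePreserving (fun j : ℕ → Fin m => Function.update j k (j k + c))
      (Measure.infinitePi fun _ : ℕ => (PMF.uniformOfFintype (Fin m)).toMeasure)
      (Measure.infinitePi fun _ : ℕ => (PMF.uniformOfFintype (Fin m)).toMeasure) := by
    have e : (fun j : ℕ → Fin m => Function.update j k (j k + c))
        = fun j i => (if i = k then Equiv.addRight c else Equiv.refl _) (j i) := by
      funext j i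
      by_cases hi : i = k
      · subst hi; simp
      · simp [hi]
    have hm (i : ℕ) : Measurable
        ((if i = k then Equiv.addRight c else Equiv.refl _ : Fin m ≃ Fin m) : Fin m → Fin m) :=
      measurable_of_finite _
    rw [e]
    refine ⟨measurable_pi_iff.2 fun i => (hm i).comp (measurable_pi_apply i), ?_⟩
    rw [Measure.infinitePi_map_pi _ hm]
    simp_rw [map_equiv_uniform]
  exact (MeasurePreserving.id _).prod h

section Expectation

variable {X F : Type*} [MeasurableSpace X] [NormedAddCommGroup F] [InnerProductSpace ℝ F]
  [MeasurableSpace F] [BorelSpace F] [SecondCountableTopology F]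
  {Y : Set ℝ} {V : ℝ → ℝ → ℝ} {Φ : X → F} {κ a₀ V₀ : ℝ}
  {ρ : Measure (X × Y)} [IsProbabilityMeasure ρ] {η : ℕ → ℝ} {m : ℕ} [NeZero m]

lemma measurable_sample_point {Z : Type*} [MeasurableSpace Z] {m : ℕ} (k : ℕ) :
    Measurable fun p : (Fin m → Z) × (ℕ → Fin m) => p.1 (p.2 k) := by
  have h : Measurable fun q : (Fin m → Z) × Fin m => q.1 q.2 :=
    measurable_from_prod_countable_left fun i => measurable_pi_apply i
  exact h.comp (f := fun p : (Fin m → Z) × (ℕ → Fin m) => (p.1, p.2 k)) (by fun_prop)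

namespace BoundedConvexLoss

lemma measurable_loss_right (h : BoundedConvexLoss Y V Φ κ a₀ V₀)
    (w : F) : Measurable (loss V Φ w : X × Y → ℝ) :=
  h.measurable_loss_uncurry.comp (f := fun z : X × Y => (w, z)) (by fun_prop)

lemma measurable_iterate (h : BoundedConvexLoss Y V Φ κ a₀ V₀)
    (k : ℕ) :
    Measurable fun p : (Fin m → X × Y) × (ℕ → Fin m) => iterate V Φ η p.1 p.2 k := by
  induction k with
  | zero => exact measurable_const
  | succ k ih =>
    rcases Nat.eq_zero_or_pos k with rfl | hk
    · exact measurable_const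
    · simp_rw [iterate_succ _ _ hk]
      have hz := measurable_sample_point (Z := X × Y) (m := m) k
      have hx : Measurable fun p : (Fin m → X × Y) × (ℕ → Fin m) => Φ (p.1 (p.2 k)).1 :=
        h.measurable_feature.comp hz.fst
      have hg : Measurable fun p : (Fin m → X × Y) × (ℕ → Fin m) =>
          leftDeriv (V (p.1 (p.2 k)).2)
            (inner ℝ (iterate V Φ η p.1 p.2 k) (Φ (p.1 (p.2 k)).1)) :=
        h.measurable_leftDeriv.comp (hz.snd.prodMk (ih.inner hx))
      exact ih.sub ((hg.const_mul _).smul hx)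

lemma integrable_loss (h : BoundedConvexLoss Y V Φ κ a₀ V₀)
    (w : F) : Integrable (loss V Φ w) ρ :=
  Integrable.of_bound (h.measurable_loss_right w).aestronglyMeasurable _
    (Filter.Eventually.of_forall fun z => h.abs_loss_le w z)

lemma risk_nonneg (h : BoundedConvexLoss Y V Φ κ a₀ V₀)
    (w : F) : 0 ≤ risk ρ V Φ w := integral_nonneg fun z => h.loss_nonneg w z

lemma abs_risk_le (h : BoundedConvexLoss Y V Φ κ a₀ V₀)
    (w : F) : |risk ρ V Φ w| ≤ V₀ + a₀ * κ * ‖w‖ := by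
  have := norm_integral_le_of_norm_le_const (μ := ρ) (f := loss V Φ w)
    (Filter.Eventually.of_forall fun z => h.abs_loss_le w z)
  rwa [probReal_univ, mul_one] at this

lemma infRisk_le (h : BoundedConvexLoss Y V Φ κ a₀ V₀)
    (w : F) : infRisk ρ V Φ ≤ risk ρ V Φ w :=
  ciInf_le ⟨0, by rintro _ ⟨w, rfl⟩; exact h.risk_nonneg w⟩ w

lemma infRisk_nonneg (h : BoundedConvexLoss Y V Φ κ a₀ V₀) : 0 ≤ infRisk ρ V Φ :=
  le_ciInf fun w => h.risk_nonneg w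

lemma measurable_risk (h : BoundedConvexLoss Y V Φ κ a₀ V₀) :
    Measurable fun w : F => risk ρ V Φ w := by
  have := h.measurable_loss_uncurry.stronglyMeasurable.integral_prod_right' (ν := ρ)
  exact this.measurable

lemma convexOn_risk (h : BoundedConvexLoss Y V Φ κ a₀ V₀) :
    ConvexOn ℝ Set.univ fun w : F => risk ρ V Φ w := by
  refine ⟨convex_univ, fun u _ v _ a b ha hb hab => ?_⟩
  have e : a • risk ρ V Φ u + b • risk ρ V Φ v
      = ∫ z, (a * loss V Φ u z + b * loss V Φ v z) ∂ρ := by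
    rw [integral_add ((h.integrable_loss u).const_mul a) ((h.integrable_loss v).const_mul b),
      integral_const_mul, integral_const_mul]
    rfl
  rw [e]
  refine integral_mono (h.integrable_loss _)
    (((h.integrable_loss u).const_mul a).add ((h.integrable_loss v).const_mul b)) fun z => ?_
  have := (h.convex z.2 z.2.2).2 (Set.mem_univ (inner ℝ u (Φ z.1)))
    (Set.mem_univ (inner ℝ v (Φ z.1))) ha hb hab
  simpa [loss, inner_add_left, real_inner_smul_left] using this

lemma measurable_loss_comp (h : BoundedConvexLoss Y V Φ κ a₀ V₀)
    {Ω : Type*} [MeasurableSpace Ω] {v : Ω → F} (hv : Measurable v)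
    {z : Ω → X × Y} (hz : Measurable z) : Measurable fun p => loss V Φ (v p) (z p) :=
  h.measurable_loss_uncurry.comp (hv.prodMk hz)

lemma integrable_loss_comp (h : BoundedConvexLoss Y V Φ κ a₀ V₀)
    {Ω : Type*} [MeasurableSpace Ω] {μ : Measure Ω} [IsFiniteMeasure μ]
    {v : Ω → F} (hv : Measurable v) {R : ℝ} (hR : ∀ p, ‖v p‖ ≤ R)
    {z : Ω → X × Y} (hz : Measurable z) : Integrable (fun p => loss V Φ (v p) (z p)) μ := by
  refine Integrable.of_bound (h.measurable_loss_comp hv hz).aestronglyMeasurable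
    (V₀ + a₀ * κ * R) (Filter.Eventually.of_forall fun p => (h.abs_loss_le _ _).trans ?_)
  have := mul_le_mul_of_nonneg_left (hR p) (mul_nonneg h.slope_nonneg h.radius_nonneg)
  linarith

lemma integrable_risk_comp (h : BoundedConvexLoss Y V Φ κ a₀ V₀)
    {Ω : Type*} [MeasurableSpace Ω] {μ : Measure Ω} [IsFiniteMeasure μ]
    {v : Ω → F} (hv : Measurable v) {R : ℝ} (hR : ∀ p, ‖v p‖ ≤ R) :
    Integrable (fun p => risk ρ V Φ (v p)) μ := by
  refine Integrable.of_bound (h.measurable_risk.comp hv).aestronglyMeasurable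
    (V₀ + a₀ * κ * R) (Filter.Eventually.of_forall fun p => (h.abs_risk_le _).trans ?_)
  have := mul_le_mul_of_nonneg_left (hR p) (mul_nonneg h.slope_nonneg h.radius_nonneg)
  linarith

lemma integrable_empRisk_comp (h : BoundedConvexLoss Y V Φ κ a₀ V₀)
    {μ : Measure ((Fin m → X × Y) × (ℕ → Fin m))} [IsFiniteMeasure μ]
    {v : (Fin m → X × Y) × (ℕ → Fin m) → F} (hv : Measurable v) {R : ℝ} (hR : ∀ p, ‖v p‖ ≤ R) :
    Integrable (fun p => empRisk V Φ p.1 (v p)) μ := by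
  unfold empRisk
  exact (integrable_finsetSum _ fun i _ =>
    h.integrable_loss_comp hv hR (by fun_prop)).const_mul _

/-- Shifting the `k`-th index by `c` changes neither the law nor `v`; averaging over all `c` turns
the selected loss into the empirical risk. -/
lemma integral_loss_selected (h : BoundedConvexLoss Y V Φ κ a₀ V₀)
    {v : (Fin m → X × Y) × (ℕ → Fin m) → F} (hv : Measurable v)
    {R : ℝ} (hR : ∀ p, ‖v p‖ ≤ R) {k : ℕ}
    (hk : ∀ z j c, v (z, Function.update j k c) = v (z, j)) :
    ∫ p, loss V Φ (v p) (p.1 (p.2 k)) ∂(jointLaw ρ m)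
      = ∫ p, empRisk V Φ p.1 (v p) ∂(jointLaw ρ m) := by
  have hm : (m : ℝ) ≠ 0 := by exact_mod_cast NeZero.ne m
  have hshift (c : Fin m) : ∫ p, loss V Φ (v p) (p.1 (p.2 k + c)) ∂(jointLaw ρ m)
      = ∫ p, loss V Φ (v p) (p.1 (p.2 k)) ∂(jointLaw ρ m) := by
    rw [← integral_comp_measurePreserving (measurePreserving_shift_index ρ k c)
      (h.measurable_loss_comp hv (measurable_sample_point k))]
    simp [hk]
  have hmeas (c : Fin m) :
      Measurable fun p : (Fin m → X × Y) × (ℕ → Fin m) => p.1 (p.2 k + c) := by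
    have h : Measurable fun q : (Fin m → X × Y) × Fin m => q.1 (q.2 + c) :=
      measurable_from_prod_countable_left fun i => measurable_pi_apply (i + c)
    exact h.comp (f := fun p : (Fin m → X × Y) × (ℕ → Fin m) => (p.1, p.2 k)) (by fun_prop)
  have hemp (p : (Fin m → X × Y) × (ℕ → Fin m)) : empRisk V Φ p.1 (v p)
      = (m : ℝ)⁻¹ * ∑ c, loss V Φ (v p) (p.1 (p.2 k + c)) := by
    unfold empRisk
    rw [← Equiv.sum_comp (Equiv.addLeft (p.2 k))]
    rfl
  simp_rw [hemp]
  rw [integral_const_mul, integral_finsetSum _ fun c _ => h.integrable_loss_comp hv hR (hmeas c)]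
  simp_rw [hshift]
  simp [hm]

lemma integral_empRisk_const (h : BoundedConvexLoss Y V Φ κ a₀ V₀)
    (w : F) :
    ∫ p, empRisk V Φ p.1 w ∂(jointLaw ρ m) = risk ρ V Φ w := by
  have hm : (m : ℝ) ≠ 0 := by exact_mod_cast NeZero.ne m
  have hi (i : Fin m) : ∫ p, loss V Φ w (p.1 i) ∂(jointLaw ρ m) = risk ρ V Φ w := by
    have hp : MeasurePreserving (fun p : (Fin m → X × Y) × (ℕ → Fin m) => p.1 i)
        (jointLaw ρ m) ρ :=
      (measurePreserving_eval (fun _ : Fin m => ρ) i).comp measurePreserving_fst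
    rw [integral_comp_measurePreserving hp (h.measurable_loss_right w)]
    rfl
  unfold empRisk
  rw [integral_const_mul, integral_finsetSum _ fun i _ =>
    h.integrable_loss_comp measurable_const (fun _ => le_rfl) (by fun_prop)]
  simp [hi, hm]

/-- Since `v` may depend on the sample, a uniform bound on the ball is needed. It is one-sided, so
it is applied to the loss and to its negative. -/
lemma abs_integral_risk_sub_empRisk_le (h : BoundedConvexLoss Y V Φ κ a₀ V₀)
    [CompleteSpace F]
    {v : (Fin m → X × Y) × (ℕ → Fin m) → F} (hv : Measurable v)
    {R : ℝ} (hR : ∀ p, ‖v p‖ ≤ R) :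
    |∫ p, risk ρ V Φ (v p) ∂(jointLaw ρ m) - ∫ p, empRisk V Φ p.1 (v p) ∂(jointLaw ρ m)|
      ≤ 2 * (a₀ * R * κ) / √m := by
  obtain ⟨p₀⟩ := nonempty_of_isProbabilityMeasure (jointLaw ρ m)
  have hR0 : 0 ≤ R := (norm_nonneg _).trans (hR p₀)
  have hB (z : X × Y) : |loss V Φ (0 : F) z| ≤ V₀ := by simpa using h.abs_loss_le 0 z
  have hfst : MeasurePreserving (Prod.fst : (Fin m → X × Y) × (ℕ → Fin m) → _)
      (jointLaw ρ m) (Measure.pi fun _ => ρ) := measurePreserving_fst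
  have transfer {D : (Fin m → X × Y) → ℝ} (hD : Integrable D (Measure.pi fun _ => ρ)) :
      Integrable (fun p => D p.1) (jointLaw ρ m) ∧
        ∫ p, D p.1 ∂(jointLaw ρ m) = ∫ z, D z ∂(Measure.pi fun _ => ρ) := by
    refine ⟨hfst.integrable_comp_of_integrable hD, ?_⟩
    rw [← hfst.map_eq, integral_map hfst.measurable.aemeasurable]
    rw [hfst.map_eq]; exact hD.aestronglyMeasurable
  have hri := h.integrable_risk_comp (ρ := ρ) (μ := jointLaw ρ m) hv hR
  have hei := h.integrable_empRisk_comp (μ := jointLaw ρ m) hv hR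
  obtain ⟨D, hD, hDle, hDint⟩ := exists_uniform_deviation ρ (l := loss V Φ)
    h.measurable_loss_right hB h.radius_nonneg (fun z => h.norm_le z.1) hR0 h.slope_nonneg
    h.abs_loss_sub_le m (NeZero.pos m)
  obtain ⟨D', hD', hDle', hDint'⟩ := exists_uniform_deviation ρ (l := fun w z => -loss V Φ w z)
    (fun w => (h.measurable_loss_right w).neg) (B := V₀)
    (fun z => by rw [abs_neg]; exact hB z) h.radius_nonneg
    (fun z => h.norm_le z.1) hR0 h.slope_nonneg
    (fun z w w' => by rw [neg_sub_neg, abs_sub_comm]; exact h.abs_loss_sub_le z w w')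
    m (NeZero.pos m)
  rw [← integral_sub hri hei]
  refine abs_le'.2 ⟨?_, ?_⟩
  · rw [← (transfer hD).2] at hDint
    exact (integral_mono (hri.sub hei) (transfer hD).1 fun p => hDle p.1 (v p) (hR p)).trans hDint
  · rw [← (transfer hD').2] at hDint'
    rw [← integral_neg]
    refine (integral_mono (hri.sub hei).neg (transfer hD').1 fun p => ?_).trans hDint'
    have := hDle' p.1 (v p) (hR p)
    rw [integral_neg, Finset.sum_neg_distrib] at this
    refine le_trans (le_of_eq ?_) this
    simp only [Pi.neg_apply, Pi.sub_apply, risk, empRisk, loss]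
    ring

/-- The comparator may be random as long as it ignores the indices from `s` on; this allows both a
fixed parameter and the iterate `wₛ`. -/
lemma sum_integral_empRisk_sub_le (h : BoundedConvexLoss Y V Φ κ a₀ V₀)
    (hη : ∀ k, 1 ≤ k → 0 < η k) {R : ℝ} {s n : ℕ} (hs : 1 ≤ s)
    (hsn : s ≤ n)
    (hR : ∀ (z : Fin m → X × Y) (j : ℕ → Fin m) k, 1 ≤ k → k ≤ n → ‖iterate V Φ η z j k‖ ≤ R)
    {v : (Fin m → X × Y) × (ℕ → Fin m) → F} (hv : Measurable v) {R' : ℝ} (hR' : ∀ p, ‖v p‖ ≤ R')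
    (hinv : ∀ k, s ≤ k → ∀ z j c, v (z, Function.update j k c) = v (z, j)) :
    ∑ k ∈ Finset.Ico s n, η k *
        (∫ p, empRisk V Φ p.1 (iterate V Φ η p.1 p.2 k) ∂(jointLaw ρ m)
          - ∫ p, empRisk V Φ p.1 (v p) ∂(jointLaw ρ m))
      ≤ (∫ p, ‖iterate V Φ η p.1 p.2 s - v p‖ ^ 2 ∂(jointLaw ρ m)) / 2
        + (a₀ * κ) ^ 2 / 2 * ∑ k ∈ Finset.Ico s n, η k ^ 2 := by
  have hw (k : ℕ) : Measurable fun p : (Fin m → X × Y) × (ℕ → Fin m) =>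
    iterate V Φ η p.1 p.2 k := h.measurable_iterate k
  have hi (k : ℕ) (hk1 : 1 ≤ k) (hkn : k ≤ n) : Integrable (fun p =>
      loss V Φ (iterate V Φ η p.1 p.2 k) (p.1 (p.2 k))) (jointLaw ρ m) :=
    h.integrable_loss_comp (hw k) (fun p => hR _ _ k hk1 hkn) (measurable_sample_point k)
  have hi' (k : ℕ) : Integrable (fun p => loss V Φ (v p) (p.1 (p.2 k))) (jointLaw ρ m) :=
    h.integrable_loss_comp hv hR' (measurable_sample_point k)
  have hnorm : Integrable (fun p => ‖iterate V Φ η p.1 p.2 s - v p‖ ^ 2) (jointLaw ρ m) := by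
    refine Integrable.of_bound (((hw s).sub hv).norm.pow_const 2).aestronglyMeasurable
      ((R + R') ^ 2) (Filter.Eventually.of_forall fun p => ?_)
    rw [Real.norm_eq_abs, abs_of_nonneg (by positivity)]
    have := (norm_sub_le _ _).trans (add_le_add (hR p.1 p.2 s hs hsn) (hR' p))
    gcongr
  have hterm (k : ℕ) (hk : k ∈ Finset.Ico s n) : Integrable (fun p => η k *
      (loss V Φ (iterate V Φ η p.1 p.2 k) (p.1 (p.2 k)) - loss V Φ (v p) (p.1 (p.2 k))))
      (jointLaw ρ m) :=
    ((hi k (hs.trans (Finset.mem_Ico.1 hk).1) (Finset.mem_Ico.1 hk).2.le).sub (hi' k)).const_mul _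
  have hpt (p : (Fin m → X × Y) × (ℕ → Fin m)) : ∑ k ∈ Finset.Ico s n, η k *
      (loss V Φ (iterate V Φ η p.1 p.2 k) (p.1 (p.2 k)) - loss V Φ (v p) (p.1 (p.2 k)))
      ≤ ‖iterate V Φ η p.1 p.2 s - v p‖ ^ 2 / 2
        + (a₀ * κ) ^ 2 / 2 * ∑ k ∈ Finset.Ico s n, η k ^ 2 := by
    have := h.norm_iterate_sub_sq_add_le p.1 p.2 hη hs hsn (v p)
    nlinarith [sq_nonneg ‖iterate V Φ η p.1 p.2 n - v p‖]
  have hmono := integral_mono (integrable_finsetSum _ hterm)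
    ((hnorm.div_const 2).add (integrable_const _)) hpt
  rw [integral_finsetSum _ hterm] at hmono
  simp only [Pi.add_apply] at hmono
  rw [integral_add (hnorm.div_const 2) (integrable_const _), integral_div, integral_const,
    probReal_univ, one_smul] at hmono
  refine le_trans (le_of_eq (Finset.sum_congr rfl fun k hk => ?_)) hmono
  obtain ⟨hk1, hk2⟩ := Finset.mem_Ico.1 hk
  rw [integral_const_mul, integral_sub (hi k (hs.trans hk1) hk2.le) (hi' k),
    h.integral_loss_selected hv hR' (hinv k hk1),
    ← h.integral_loss_selected (hw k) (fun p => hR _ _ k (hs.trans hk1) hk2.le)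
      (fun z j c => iterate_update z j k c le_rfl)]

end BoundedConvexLoss

end Expectation

/-! ### Rates for the average and for the last iterate -/

section Rates

variable {X F : Type*} [MeasurableSpace X] [NormedAddCommGroup F] [InnerProductSpace ℝ F]
  [CompleteSpace F] [MeasurableSpace F] [BorelSpace F] [SecondCountableTopology F]
  {Y : Set ℝ} {V : ℝ → ℝ → ℝ} {Φ : X → F} {κ a₀ V₀ : ℝ}
  {ρ : Measure (X × Y)} [IsProbabilityMeasure ρ] {η : ℕ → ℝ} {m : ℕ} [NeZero m]

/-- The expected risk of the `k`-th iterate, averaged over the sample and the index sequence. -/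
def meanRisk (ρ : Measure (X × Y)) (V : ℝ → ℝ → ℝ) (Φ : X → F) (η : ℕ → ℝ) (m : ℕ) [NeZero m]
    (k : ℕ) : ℝ :=
  ∫ p, risk ρ V Φ (iterate V Φ η p.1 p.2 k) ∂(jointLaw ρ m)

/-- The constant in front of `√(∑ ηₖ / m)` in the bound for the sample error of the iterates. -/
def sampleConst (κ a₀ V₀ b : ℝ) : ℝ := 2 * (a₀ * κ) * √((a₀ * κ) ^ 2 * b + 2 * V₀)

lemma sum_pos_of_pos (hη : ∀ k, 1 ≤ k → 0 < η k) {t : ℕ} (ht : 1 ≤ t) :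
    0 < ∑ k ∈ Finset.Icc 1 t, η k :=
  Finset.sum_pos (fun k hk => hη k (Finset.mem_Icc.1 hk).1) ⟨1, Finset.mem_Icc.2 ⟨le_rfl, ht⟩⟩

namespace BoundedConvexLoss

lemma sampleConst_nonneg (h : BoundedConvexLoss Y V Φ κ a₀ V₀) {b : ℝ} :
    0 ≤ sampleConst κ a₀ V₀ b :=
  mul_nonneg (mul_nonneg zero_le_two (mul_nonneg h.slope_nonneg h.radius_nonneg))
    (Real.sqrt_nonneg _)

lemma risk_avgIterate_le (h : BoundedConvexLoss Y V Φ κ a₀ V₀) (hη : ∀ k, 1 ≤ k → 0 < η k)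
    {t : ℕ} (ht : 1 ≤ t) (z : Fin m → X × Y) (j : ℕ → Fin m) :
    risk ρ V Φ (avgIterate V Φ η z j t) ≤ (∑ k ∈ Finset.Icc 1 t, η k)⁻¹
      * ∑ k ∈ Finset.Icc 1 t, η k * risk ρ V Φ (iterate V Φ η z j k) := by
  have := (h.convexOn_risk (ρ := ρ)).map_centerMass_le (t := Finset.Icc 1 t) (w := η)
    (p := fun k => iterate V Φ η z j k) (fun k hk => (hη k (Finset.mem_Icc.1 hk).1).le)
    (sum_pos_of_pos hη ht) (fun _ _ => Set.mem_univ _)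
  simpa [Finset.centerMass, avgIterate] using this

lemma abs_meanRisk_sub_le (h : BoundedConvexLoss Y V Φ κ a₀ V₀)
    (hη : ∀ k, 1 ≤ k → 0 < η k) {b : ℝ} (hb : ∀ k, 1 ≤ k → η k ≤ b)
    {k t : ℕ} (hk : 1 ≤ k) (hkt : k ≤ t) :
    |meanRisk ρ V Φ η m k
        - ∫ p, empRisk V Φ p.1 (iterate V Φ η p.1 p.2 k) ∂(jointLaw ρ m)|
      ≤ sampleConst κ a₀ V₀ b * √((∑ i ∈ Finset.Icc 1 t, η i) / m) := by
  refine (h.abs_integral_risk_sub_empRisk_le (h.measurable_iterate k)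
    fun p => h.norm_iterate_le p.1 p.2 hη hb hk hkt).trans_eq ?_
  have hb0 : 0 ≤ b := (hη 1 le_rfl).le.trans (hb 1 le_rfl)
  rw [Real.sqrt_mul (add_nonneg (mul_nonneg (sq_nonneg _) hb0)
      (mul_nonneg zero_le_two h.bound_nonneg)),
    Real.sqrt_div (sum_pos_of_pos hη (hk.trans hkt)).le]
  unfold sampleConst
  ring

lemma integrable_risk_iterate (h : BoundedConvexLoss Y V Φ κ a₀ V₀)
    (hη : ∀ k, 1 ≤ k → 0 < η k) {b : ℝ} (hb : ∀ k, 1 ≤ k → η k ≤ b)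
    {k : ℕ} (hk : 1 ≤ k) :
    Integrable (fun p => risk ρ V Φ (iterate V Φ η p.1 p.2 k)) (jointLaw ρ m) :=
  h.integrable_risk_comp (h.measurable_iterate k)
    fun p => h.norm_iterate_le p.1 p.2 hη hb hk le_rfl

lemma infRisk_le_meanRisk (h : BoundedConvexLoss Y V Φ κ a₀ V₀)
    (hη : ∀ k, 1 ≤ k → 0 < η k) {b : ℝ} (hb : ∀ k, 1 ≤ k → η k ≤ b)
    {k : ℕ} (hk : 1 ≤ k) :
    infRisk ρ V Φ ≤ meanRisk ρ V Φ η m k := by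
  have := integral_mono (μ := jointLaw ρ m) (integrable_const (infRisk ρ V Φ))
    (h.integrable_risk_iterate (m := m) hη hb hk) fun p => h.infRisk_le _
  rwa [integral_const, probReal_univ, one_smul] at this

/-- Only the iterates pay the deviation, since the empirical risk of a fixed `w` is unbiased; `‖w‖ ^
2 / 2` is the initial distance from `w₁ = 0`. -/
lemma sum_meanRisk_sub_risk_le (h : BoundedConvexLoss Y V Φ κ a₀ V₀)
    (hη : ∀ k, 1 ≤ k → 0 < η k) {b : ℝ} (hb : ∀ k, 1 ≤ k → η k ≤ b)
    (t : ℕ) (w : F) :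
    ∑ k ∈ Finset.Icc 1 t, η k * (meanRisk ρ V Φ η m k - risk ρ V Φ w)
      ≤ (∑ k ∈ Finset.Icc 1 t, η k)
          * (sampleConst κ a₀ V₀ b * √((∑ i ∈ Finset.Icc 1 t, η i) / m))
        + ‖w‖ ^ 2 / 2 + (a₀ * κ) ^ 2 / 2 * ∑ k ∈ Finset.Icc 1 t, η k ^ 2 := by
  have h1 := h.sum_integral_empRisk_sub_le (ρ := ρ) (m := m) hη le_rfl (Nat.le_add_left 1 t)
    (fun z j k hk1 hk2 => h.norm_iterate_le z j hη hb hk1 hk2)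
    (v := fun _ => w) measurable_const (fun _ => le_rfl) (fun _ _ _ _ _ => rfl)
  have h0 (z : Fin m → X × Y) (j : ℕ → Fin m) : iterate V Φ η z j 1 = 0 := rfl
  simp only [h0, h.integral_empRisk_const, zero_sub, norm_neg, integral_const, probReal_univ,
    one_smul, Finset.Ico_add_one_right_eq_Icc] at h1
  rw [Finset.sum_mul, add_assoc]
  refine le_trans ?_ (add_le_add le_rfl h1)
  rw [← Finset.sum_add_distrib]
  refine Finset.sum_le_sum fun k hk => ?_
  obtain ⟨hk1, hk2⟩ := Finset.mem_Icc.1 hk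
  have h2 := (abs_le.1 (h.abs_meanRisk_sub_le (ρ := ρ) (m := m) hη hb hk1 hk2)).2
  rw [← mul_add]
  exact mul_le_mul_of_nonneg_left (by linarith) (hη k hk1).le

/-- With comparator `wₛ` the initial distance vanishes, but both iterates depend on the sample, so
the deviation is paid twice. -/
lemma sum_meanRisk_sub_meanRisk_le (h : BoundedConvexLoss Y V Φ κ a₀ V₀)
    (hη : ∀ k, 1 ≤ k → 0 < η k) {b : ℝ} (hb : ∀ k, 1 ≤ k → η k ≤ b)
    {s t : ℕ} (hs : 1 ≤ s) (hst : s ≤ t) :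
    ∑ k ∈ Finset.Ico s (t + 1), η k * (meanRisk ρ V Φ η m k - meanRisk ρ V Φ η m s)
      ≤ ∑ k ∈ Finset.Ico s (t + 1), ((a₀ * κ) ^ 2 / 2 * η k ^ 2
        + 2 * (sampleConst κ a₀ V₀ b * √((∑ i ∈ Finset.Icc 1 t, η i) / m)) * η k) := by
  have h1 := h.sum_integral_empRisk_sub_le (ρ := ρ) (m := m) hη hs (n := t + 1) (by omega)
    (fun z j k hk1 hk2 => h.norm_iterate_le z j hη hb hk1 hk2)
    (v := fun p => iterate V Φ η p.1 p.2 s) (h.measurable_iterate s)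
    (fun p => h.norm_iterate_le p.1 p.2 hη hb hs le_rfl)
    (fun k hk z j c => iterate_update z j k c hk)
  simp only [sub_self, norm_zero, ne_eq, OfNat.ofNat_ne_zero, not_false_eq_true, zero_pow,
    integral_zero, zero_div, zero_add] at h1
  rw [Finset.sum_add_distrib, ← Finset.mul_sum]
  refine le_trans ?_ (add_le_add h1 le_rfl)
  rw [← Finset.sum_add_distrib]
  refine Finset.sum_le_sum fun k hk => ?_
  obtain ⟨hk1, hk2⟩ := Finset.mem_Ico.1 hk
  have h2 := (abs_le.1 (h.abs_meanRisk_sub_le (ρ := ρ) (m := m) hη hb (hs.trans hk1)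
    (Nat.le_of_lt_succ hk2))).2
  have h3 := (abs_le.1 (h.abs_meanRisk_sub_le (ρ := ρ) (m := m) hη hb hs hst)).1
  rw [mul_comm _ (η k), ← mul_add]
  exact mul_le_mul_of_nonneg_left (by linarith) (hη k (hs.trans hk1)).le

lemma sum_meanRisk_sub_infRisk_le (h : BoundedConvexLoss Y V Φ κ a₀ V₀)
    (hη : ∀ k, 1 ≤ k → 0 < η k) {b : ℝ} (hb : ∀ k, 1 ≤ k → η k ≤ b)
    {c β : ℝ}
    (happ : ∀ lam : ℝ, 0 < lam → approxError ρ V Φ lam ≤ c * lam ^ β) {t : ℕ} (ht : 1 ≤ t) :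
    ∑ k ∈ Finset.Icc 1 t, η k * (meanRisk ρ V Φ η m k - infRisk ρ V Φ)
      ≤ (∑ k ∈ Finset.Icc 1 t, η k)
          * (sampleConst κ a₀ V₀ b * √((∑ i ∈ Finset.Icc 1 t, η i) / m))
        + (a₀ * κ) ^ 2 / 2 * ∑ k ∈ Finset.Icc 1 t, η k ^ 2
        + (∑ k ∈ Finset.Icc 1 t, η k) * (c * (1 / ∑ k ∈ Finset.Icc 1 t, η k) ^ β) := by
  have hS := sum_pos_of_pos hη ht
  have hlam := happ (1 / ∑ k ∈ Finset.Icc 1 t, η k) (by positivity)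
  have key (w : F) := h.sum_meanRisk_sub_risk_le (ρ := ρ) (m := m) hη hb t w
  have split (a : ℝ) : ∑ k ∈ Finset.Icc 1 t, η k * (meanRisk ρ V Φ η m k - a)
      = ∑ k ∈ Finset.Icc 1 t, η k * meanRisk ρ V Φ η m k - (∑ k ∈ Finset.Icc 1 t, η k) * a := by
    simp only [mul_sub, Finset.sum_sub_distrib, Finset.sum_mul]
  simp only [split] at key ⊢
  set S := ∑ k ∈ Finset.Icc 1 t, η k
  set gap := sampleConst κ a₀ V₀ b * √(S / m)
  set T := ∑ k ∈ Finset.Icc 1 t, η k * meanRisk ρ V Φ η m k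
  set Q := (a₀ * κ) ^ 2 / 2 * ∑ k ∈ Finset.Icc 1 t, η k ^ 2
  -- Divided by `S`, the term `‖w‖ ^ 2 / 2` is exactly the penalty for `lam = 1 / S`. Taking the
  -- infimum over `w` avoids any need for a minimizer.
  have hinf : (T - S * gap - Q) / S ≤ ⨅ w : F, (risk ρ V Φ w + 1 / S / 2 * ‖w‖ ^ 2) := by
    refine le_ciInf fun w => ?_
    rw [div_le_iff₀ hS]
    have e : (risk ρ V Φ w + 1 / S / 2 * ‖w‖ ^ 2) * S = S * risk ρ V Φ w + ‖w‖ ^ 2 / 2 := by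
      field_simp
    rw [e]
    linarith [key w]
  unfold approxError at hlam
  have h1 : (T - S * gap - Q) / S ≤ c * (1 / S) ^ β + infRisk ρ V Φ := by linarith
  rw [div_le_iff₀ hS] at h1
  linarith

lemma integrable_risk_avgIterate (h : BoundedConvexLoss Y V Φ κ a₀ V₀)
    (hη : ∀ k, 1 ≤ k → 0 < η k) {b : ℝ} (hb : ∀ k, 1 ≤ k → η k ≤ b)
    {t : ℕ} (ht : 1 ≤ t) :
    Integrable (fun p => risk ρ V Φ (avgIterate V Φ η p.1 p.2 t)) (jointLaw ρ m) := by
  have hm : Measurable fun p : (Fin m → X × Y) × (ℕ → Fin m) =>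
      avgIterate V Φ η p.1 p.2 t := by
    unfold avgIterate
    exact (Finset.measurable_fun_sum _ fun k _ =>
      (h.measurable_iterate k).const_smul (η k)).const_smul _
  have hdom : Integrable (fun p => (∑ k ∈ Finset.Icc 1 t, η k)⁻¹
      * ∑ k ∈ Finset.Icc 1 t, η k * risk ρ V Φ (iterate V Φ η p.1 p.2 k)) (jointLaw ρ m) :=
    (integrable_finsetSum _ fun k hk => (h.integrable_risk_iterate hη hb
      (Finset.mem_Icc.1 hk).1).const_mul _).const_mul _
  refine hdom.mono' (h.measurable_risk.comp hm).aestronglyMeasurable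
    (Filter.Eventually.of_forall fun p => ?_)
  rw [Real.norm_eq_abs, abs_of_nonneg (h.risk_nonneg _)]
  exact h.risk_avgIterate_le hη ht _ _

lemma integral_risk_avgIterate_sub_le (h : BoundedConvexLoss Y V Φ κ a₀ V₀)
    (hη : ∀ k, 1 ≤ k → 0 < η k) {b : ℝ} (hb : ∀ k, 1 ≤ k → η k ≤ b)
    {c β : ℝ}
    (happ : ∀ lam : ℝ, 0 < lam → approxError ρ V Φ lam ≤ c * lam ^ β) {t : ℕ} (ht : 1 ≤ t) :
    ∫ p, (risk ρ V Φ (avgIterate V Φ η p.1 p.2 t) - infRisk ρ V Φ) ∂(jointLaw ρ m)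
      ≤ sampleConst κ a₀ V₀ b * √((∑ i ∈ Finset.Icc 1 t, η i) / m)
        + (a₀ * κ) ^ 2 / 2 * ((∑ k ∈ Finset.Icc 1 t, η k ^ 2) / ∑ k ∈ Finset.Icc 1 t, η k)
        + c * (1 / ∑ k ∈ Finset.Icc 1 t, η k) ^ β := by
  have hS := sum_pos_of_pos hη ht
  have h1 := h.sum_meanRisk_sub_infRisk_le (ρ := ρ) (m := m) hη hb happ ht
  have hi (k : ℕ) (hk : k ∈ Finset.Icc 1 t) : Integrable (fun p =>
      η k * risk ρ V Φ (iterate V Φ η p.1 p.2 k)) (jointLaw ρ m) :=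
    (h.integrable_risk_iterate hη hb (Finset.mem_Icc.1 hk).1).const_mul _
  have h2 := integral_mono (h.integrable_risk_avgIterate (m := m) hη hb ht)
    ((integrable_finsetSum _ hi).const_mul _)
    fun p => h.risk_avgIterate_le hη ht p.1 p.2
  rw [integral_const_mul, integral_finsetSum _ hi] at h2
  simp only [integral_const_mul] at h2
  rw [integral_sub (h.integrable_risk_avgIterate hη hb ht) (integrable_const _), integral_const,
    probReal_univ, one_smul]
  simp only [mul_sub, Finset.sum_sub_distrib] at h1
  rw [← Finset.sum_mul] at h1
  change _ ≤ _ * ∑ k ∈ Finset.Icc 1 t, η k * meanRisk ρ V Φ η m k at h2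
  refine (sub_le_sub_right h2 _).trans ?_
  rw [inv_mul_eq_div, sub_le_iff_le_add, div_le_iff₀ hS]
  have e : (∑ k ∈ Finset.Icc 1 t, η k ^ 2) / (∑ k ∈ Finset.Icc 1 t, η k)
      * ∑ k ∈ Finset.Icc 1 t, η k = ∑ k ∈ Finset.Icc 1 t, η k ^ 2 := div_mul_cancel₀ _ hS.ne'
  rw [add_mul, add_mul, add_mul, mul_assoc (_ / 2), e]
  linarith

lemma mul_meanRisk_sub_infRisk_le (h : BoundedConvexLoss Y V Φ κ a₀ V₀)
    (hη : ∀ k, 1 ≤ k → 0 < η k) {b : ℝ} (hb : ∀ k, 1 ≤ k → η k ≤ b)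
    (hanti : ∀ k, 1 ≤ k → η (k + 1) ≤ η k) {c β : ℝ}
    (happ : ∀ lam : ℝ, 0 < lam → approxError ρ V Φ lam ≤ c * lam ^ β) {t : ℕ} (ht : 1 ≤ t) :
    η t * (meanRisk ρ V Φ η m t - infRisk ρ V Φ)
      ≤ 1 / t * ((∑ k ∈ Finset.Icc 1 t, η k) * (c * (1 / ∑ k ∈ Finset.Icc 1 t, η k) ^ β))
        + (∑ k ∈ Finset.Ico 1 t, 1 / ((t : ℝ) - k) * ((a₀ * κ) ^ 2 / 2 * η k ^ 2
          + 2 * (sampleConst κ a₀ V₀ b * √((∑ i ∈ Finset.Icc 1 t, η i) / m)) * η k))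
        + ((a₀ * κ) ^ 2 / 2 * η t ^ 2
          + 2 * (sampleConst κ a₀ V₀ b * √((∑ i ∈ Finset.Icc 1 t, η i) / m)) * η t) := by
  have hS := sum_pos_of_pos hη ht
  have hsum := h.sum_meanRisk_sub_infRisk_le (ρ := ρ) (m := m) hη hb happ ht
  have hwin (s : ℕ) := h.sum_meanRisk_sub_meanRisk_le (ρ := ρ) (m := m) hη hb (s := s) (t := t)
  have hu (k : ℕ) (hk : 1 ≤ k) := h.infRisk_le_meanRisk (ρ := ρ) (m := m) hη hb hk
  have hgap : 0 ≤ sampleConst κ a₀ V₀ b * √((∑ i ∈ Finset.Icc 1 t, η i) / m) :=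
    mul_nonneg h.sampleConst_nonneg (Real.sqrt_nonneg _)
  have hmono {i k : ℕ} (hi : 1 ≤ i) (hik : i ≤ k) : η k ≤ η i := by
    induction k, hik using Nat.le_induction with
    | base => exact le_rfl
    | succ k hk ih => exact (hanti k (hi.trans hk)).trans ih
  set S := ∑ k ∈ Finset.Icc 1 t, η k
  set gap := sampleConst κ a₀ V₀ b * √(S / m)
  set U := meanRisk ρ V Φ η m
  set u₀ := infRisk ρ V Φ
  set B : ℕ → ℝ := fun k => (a₀ * κ) ^ 2 / 2 * η k ^ 2 + 2 * gap * η k with hB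
  have hreflect (f : ℕ → ℝ) (k : ℕ) (hk : k ≤ t + 1) :
      ∑ r ∈ Finset.range k, f (t - r) = ∑ i ∈ Finset.Ico (t + 1 - k) (t + 1), f i := by
    rw [Finset.range_eq_Ico, Finset.sum_Ico_reflect f 0 hk]
    simp
  -- Time is reversed, so that `r = 0` is the last iterate; its weight `1` in `c` is a separate
  -- case, as `1 / (t - k)` makes no sense at `k = t`.
  have key := le_average_add_of_sum_sub_le (A := fun r => η (t - r) * (U (t - r) - u₀))
    (B := fun r => B (t - r)) (c := fun r => if r = 0 then 1 else 1 / (r : ℝ)) (by simp)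
    (fun r hr => by simp [Nat.one_le_iff_ne_zero.1 hr]) (t := t) (fun k hk hkt => by
      rw [hreflect B (k + 1) (by omega), show t + 1 - (k + 1) = t - k by omega]
      refine le_trans ?_ (hwin (t - k) (by omega) (by omega))
      have e := hreflect (fun i => η i * (U i - U (t - k))) (k + 1) (by omega)
      rw [show t + 1 - (k + 1) = t - k by omega] at e
      rw [← e, Finset.sum_range_succ, sub_self, mul_zero, add_zero]
      refine Finset.sum_le_sum fun r hr => ?_
      have hr' := Finset.mem_range.1 hr
      -- Monotone step sizes together with `u₀ ≤ U (t - k)` let the weight `η (t - k)` on the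
      -- comparator be lowered to `η (t - r)`.
      have h1 := hmono (i := t - k) (k := t - r) (by omega) (by omega)
      have h2 := hu (t - k) (by omega)
      nlinarith) ht le_rfl
  have e1 := hreflect (fun i => η i * (U i - u₀) - B i) t (by omega)
  have e2 := hreflect (fun i => (if t - i = 0 then 1 else 1 / ((t - i : ℕ) : ℝ)) * B i) t
    (by omega)
  rw [show t + 1 - t = 1 by omega] at e1 e2
  have e3 : ∑ r ∈ Finset.range t, (if r = 0 then 1 else 1 / (r : ℝ)) * B (t - r)
      = ∑ r ∈ Finset.range t,
        (if t - (t - r) = 0 then 1 else 1 / ((t - (t - r) : ℕ) : ℝ)) * B (t - r) :=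
    Finset.sum_congr rfl fun r hr => by
      rw [show t - (t - r) = r by have := Finset.mem_range.1 hr; omega]
  rw [e3, e2, e1, Finset.sum_Ico_succ_top ht (fun i =>
    (if t - i = 0 then 1 else 1 / ((t - i : ℕ) : ℝ)) * B i), Nat.sub_self, if_pos rfl, one_mul,
    Nat.sub_zero, ← add_assoc, Finset.Ico_add_one_right_eq_Icc, Finset.sum_sub_distrib] at key
  refine key.trans (add_le_add (add_le_add ?_ (le_of_eq ?_)) le_rfl)
  · refine mul_le_mul_of_nonneg_left ?_ (by positivity)
    -- Subtracting the sum of `B` cancels the squared step sizes in `hsum` and leaves `-gap * S`,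
    -- which is dropped.
    have e4 : ∑ i ∈ Finset.Icc 1 t, B i
        = (a₀ * κ) ^ 2 / 2 * ∑ k ∈ Finset.Icc 1 t, η k ^ 2 + 2 * gap * S := by
      rw [hB, Finset.sum_add_distrib, ← Finset.mul_sum, ← Finset.mul_sum]
    rw [e4]
    nlinarith [mul_nonneg hS.le hgap]
  · refine Finset.sum_congr rfl fun i hi => ?_
    have hi2 := (Finset.mem_Ico.1 hi).2
    rw [if_neg (by omega), Nat.cast_sub hi2.le]

lemma meanRisk_sub_infRisk_le (h : BoundedConvexLoss Y V Φ κ a₀ V₀)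
    (hη : ∀ k, 1 ≤ k → 0 < η k) {b : ℝ} (hb : ∀ k, 1 ≤ k → η k ≤ b)
    (hanti : ∀ k, 1 ≤ k → η (k + 1) ≤ η k) {c β : ℝ}
    (happ : ∀ lam : ℝ, 0 < lam → approxError ρ V Φ lam ≤ c * lam ^ β) {t : ℕ} (ht : 2 ≤ t) :
    meanRisk ρ V Φ η m t - infRisk ρ V Φ
      ≤ 4 * sampleConst κ a₀ V₀ b * (√((∑ k ∈ Finset.Icc 1 t, η k) / m) *
            (∑ k ∈ Finset.Ico 1 t, η k / (η t * ((t : ℝ) - (k : ℝ)))))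
        + (a₀ * κ) ^ 2 / 2 * (∑ k ∈ Finset.Ico 1 t, η k ^ 2 / (η t * ((t : ℝ) - (k : ℝ))))
        + (a₀ * κ) ^ 2 / 2 * η t
        + c * ((∑ k ∈ Finset.Icc 1 t, η k) ^ (1 - β) / (η t * t)) := by
  have key := h.mul_meanRisk_sub_infRisk_le (ρ := ρ) (m := m) hη hb hanti happ
    (one_le_two.trans ht)
  have hS := sum_pos_of_pos hη (one_le_two.trans ht)
  have hηt := hη t (one_le_two.trans ht)
  have ht0 : (0 : ℝ) < t := by exact_mod_cast (by omega : 0 < t)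
  have hgap : 0 ≤ sampleConst κ a₀ V₀ b * √((∑ i ∈ Finset.Icc 1 t, η i) / m) :=
    mul_nonneg h.sampleConst_nonneg (Real.sqrt_nonneg _)
  -- The term `k = t - 1` alone is at least `1`. This absorbs the isolated `2 * gap` into the sum
  -- and produces the constant `4`; it requires `2 ≤ t`.
  have hone : 1 ≤ ∑ k ∈ Finset.Ico 1 t, η k / (η t * ((t : ℝ) - (k : ℝ))) := by
    obtain ⟨s, rfl⟩ := Nat.exists_eq_add_of_le' (one_le_two.trans ht)
    have hs : s ∈ Finset.Ico 1 (s + 1) := Finset.mem_Ico.2 ⟨by omega, by omega⟩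
    refine le_trans ?_ (Finset.single_le_sum (f := fun k : ℕ =>
      η k / (η (s + 1) * (((s + 1 : ℕ) : ℝ) - (k : ℝ)))) (fun k hk => ?_) hs)
    · rw [le_div_iff₀ (by push_cast; nlinarith)]
      push_cast
      linarith [hanti s (by omega)]
    · obtain ⟨hk1, hk2⟩ := Finset.mem_Ico.1 hk
      have : (k : ℝ) < ((s + 1 : ℕ) : ℝ) := by exact_mod_cast hk2
      exact div_nonneg (hη k hk1).le (mul_nonneg hηt.le (by linarith))
  have e1 : (∑ k ∈ Finset.Icc 1 t, η k) * (c * (1 / ∑ k ∈ Finset.Icc 1 t, η k) ^ β)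
      = c * (∑ k ∈ Finset.Icc 1 t, η k) ^ (1 - β) := by
    rw [one_div, Real.inv_rpow hS.le, Real.rpow_sub hS, Real.rpow_one]
    ring
  rw [e1] at key
  set S := ∑ k ∈ Finset.Icc 1 t, η k
  set gap := sampleConst κ a₀ V₀ b * √(S / m) with hgapdef
  have e2 : ∑ k ∈ Finset.Ico 1 t, 1 / ((t : ℝ) - k) * ((a₀ * κ) ^ 2 / 2 * η k ^ 2
        + 2 * gap * η k)
      = η t * ((a₀ * κ) ^ 2 / 2 * (∑ k ∈ Finset.Ico 1 t, η k ^ 2 / (η t * ((t : ℝ) - (k : ℝ))))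
        + 2 * gap * ∑ k ∈ Finset.Ico 1 t, η k / (η t * ((t : ℝ) - (k : ℝ)))) := by
    rw [Finset.mul_sum, Finset.mul_sum, ← Finset.sum_add_distrib, Finset.mul_sum]
    refine Finset.sum_congr rfl fun k hk => ?_
    have : (k : ℝ) < t := by exact_mod_cast (Finset.mem_Ico.1 hk).2
    have hne : (t : ℝ) - k ≠ 0 := by linarith
    field_simp
  rw [e2] at key
  set H₁ := ∑ k ∈ Finset.Ico 1 t, η k / (η t * ((t : ℝ) - (k : ℝ)))
  set H₂ := ∑ k ∈ Finset.Ico 1 t, η k ^ 2 / (η t * ((t : ℝ) - (k : ℝ)))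
  refine le_of_mul_le_mul_left (key.trans ?_) hηt
  have e3 : η t * (c * (S ^ (1 - β) / (η t * t))) = 1 / t * (c * S ^ (1 - β)) := by
    field_simp
  have e4 := mul_nonneg hηt.le (mul_nonneg hgap (sub_nonneg.2 hone))
  have e5 : 4 * sampleConst κ a₀ V₀ b * (√(S / m) * H₁) = 4 * (gap * H₁) := by
    rw [hgapdef]; ring
  rw [← e3, e5]
  generalize S ^ (1 - β) / (η t * t) = x
  linarith

end BoundedConvexLoss

end Rates

/-- Needed at `t = 1`, where the sums over `k < t` are empty and the two remaining terms, with `x =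
η 1`, must dominate a constant. -/
lemma one_le_add_rpow_div {x β : ℝ} (hx : 0 < x) (hβ : 0 ≤ β) : 1 ≤ x + x ^ (1 - β) / x := by
  rcases le_total 1 x with h | h
  · have : 0 ≤ x ^ (1 - β) / x := by positivity
    linarith
  · have h1 := Real.rpow_le_rpow_of_exponent_ge hx h (by linarith : 1 - β ≤ 1)
    rw [Real.rpow_one] at h1
    have : 1 ≤ x ^ (1 - β) / x := (one_le_div hx).2 h1
    linarith

end SGM

end

/-! ### Assembly of the two bounds -/

theorem theorem3 (κ a₀ V₀ c_β η_max : ℝ) :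
    ∃ C : ℝ, 0 < C ∧
      ∀ (X : Type*) [MeasurableSpace X]
        (F : Type*) [NormedAddCommGroup F] [InnerProductSpace ℝ F] [CompleteSpace F]
        [TopologicalSpace.SeparableSpace F] [MeasurableSpace F] [BorelSpace F]
        (Y : Set ℝ) (ρ : Measure (X × Y)) [IsProbabilityMeasure ρ]
        (V : ℝ → ℝ → ℝ) (Φ : X → F) (β : ℝ) (η : ℕ → ℝ) (m : ℕ) [NeZero m],
        -- the loss and the feature map
        Measurable (Function.uncurry V) →
        (∀ y a, 0 ≤ V y a) →
        Measurable Φ →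
        -- boundedness and convexity
        (∀ x, ‖Φ x‖ ≤ κ) →
        (∀ y ∈ Y, ConvexOn ℝ Set.univ (V y)) →
        (∀ y ∈ Y, V y 0 ≤ V₀) →
        (∀ y ∈ Y, ∀ a, |SGM.leftDeriv (V y) a| ≤ a₀) →
        -- decay of the approximation error
        0 < β → β ≤ 1 → 0 < c_β →
        (∀ lam : ℝ, 0 < lam → SGM.approxError ρ V Φ lam ≤ c_β * lam ^ β) →
        -- positive non-increasing step-sizes
        (∀ k, 1 ≤ k → 0 < η k) →
        (∀ k, 1 ≤ k → η (k + 1) ≤ η k) →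
        η 1 ≤ η_max →
        ∀ t : ℕ, 1 ≤ t →
          (Integrable (fun p => SGM.risk ρ V Φ (SGM.avgIterate V Φ η p.1 p.2 t) -
              SGM.infRisk ρ V Φ) (SGM.jointLaw ρ m) ∧
            ∫ p, (SGM.risk ρ V Φ (SGM.avgIterate V Φ η p.1 p.2 t) -
                SGM.infRisk ρ V Φ) ∂(SGM.jointLaw ρ m) ≤
              C * (√((∑ k ∈ Finset.Icc 1 t, η k) / m)
                + (∑ k ∈ Finset.Icc 1 t, η k ^ 2) / (∑ k ∈ Finset.Icc 1 t, η k)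
                + (1 / ∑ k ∈ Finset.Icc 1 t, η k) ^ β)) ∧
          (Integrable (fun p => SGM.risk ρ V Φ (SGM.iterate V Φ η p.1 p.2 t) -
              SGM.infRisk ρ V Φ) (SGM.jointLaw ρ m) ∧
            ∫ p, (SGM.risk ρ V Φ (SGM.iterate V Φ η p.1 p.2 t) -
                SGM.infRisk ρ V Φ) ∂(SGM.jointLaw ρ m) ≤
              C * (√((∑ k ∈ Finset.Icc 1 t, η k) / m) *
                  (∑ k ∈ Finset.Ico 1 t, η k / (η t * ((t : ℝ) - (k : ℝ))))
                + (∑ k ∈ Finset.Ico 1 t, η k ^ 2 / (η t * ((t : ℝ) - (k : ℝ))))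
                + η t
                + (∑ k ∈ Finset.Icc 1 t, η k) ^ (1 - β) / (η t * t))) := by
  set A := SGM.sampleConst κ a₀ V₀ η_max with hA
  set G := (a₀ * κ) ^ 2 / 2 with hG
  have hG0 : 0 ≤ G := by positivity
  -- `|V₀|` serves the case `t = 1` and `1` ensures positivity. Absolute values are taken because
  -- the parameters are still arbitrary reals here.
  refine ⟨1 + 4 * |A| + G + |c_β| + |V₀|, by positivity, ?_⟩
  set C := 1 + 4 * |A| + G + |c_β| + |V₀| with hC
  have hC0 : 0 ≤ C := by positivity
  have hCA : 4 * A ≤ C := by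
    linarith [le_abs_self A, abs_nonneg c_β, abs_nonneg V₀]
  have hCA' : A ≤ C := by
    linarith [le_abs_self A, abs_nonneg A, abs_nonneg c_β, abs_nonneg V₀]
  have hCG : G ≤ C := by linarith [abs_nonneg A, abs_nonneg c_β, abs_nonneg V₀]
  have hCc : c_β ≤ C := by linarith [abs_nonneg A, le_abs_self c_β, abs_nonneg V₀]
  have hCV : V₀ ≤ C := by linarith [abs_nonneg A, abs_nonneg c_β, le_abs_self V₀]
  intro X _ F _ _ _ _ _ _ Y ρ _ V Φ β η m _ hVm hV0 hΦm hΦ hconv hVz hder hβ _ _ happ hη hanti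
    hηmax t ht
  have : SecondCountableTopology F := UniformSpace.secondCountable_of_separable F
  -- A point of `X × Y` yields the signs of `κ`, `a₀` and `V₀` from the bounds they satisfy there.
  obtain ⟨z⟩ := nonempty_of_isProbabilityMeasure ρ
  have h : SGM.BoundedConvexLoss Y V Φ κ a₀ V₀ :=
    { measurable_loss := hVm
      nonneg := hV0
      measurable_feature := hΦm
      norm_le := hΦ
      convex := hconv
      loss_zero_le := hVz
      abs_leftDeriv_le := hder
      radius_nonneg := (norm_nonneg _).trans (hΦ z.1)
      slope_nonneg := (abs_nonneg _).trans (hder z.2 z.2.2 0)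
      bound_nonneg := (hV0 _ _).trans (hVz z.2 z.2.2) }
  have hb (k : ℕ) (hk : 1 ≤ k) : η k ≤ η_max := by
    induction k, hk using Nat.le_induction with
    | base => exact hηmax
    | succ k hk ih => exact (hanti k hk).trans ih
  have hS := SGM.sum_pos_of_pos hη ht
  have hηt := hη t ht
  have hpos₂ : 0 ≤ ∑ k ∈ Finset.Icc 1 t, η k ^ 2 := Finset.sum_nonneg fun _ _ => sq_nonneg _
  have hH (p : ℕ) : 0 ≤ ∑ k ∈ Finset.Ico 1 t, η k ^ p / (η t * ((t : ℝ) - (k : ℝ))) :=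
    Finset.sum_nonneg fun k hk => by
      obtain ⟨hk1, hk2⟩ := Finset.mem_Ico.1 hk
      have : (k : ℝ) < t := by exact_mod_cast hk2
      exact div_nonneg (pow_nonneg (hη k hk1).le p) (mul_nonneg hηt.le (by linarith))
  have hH₁ := hH 1
  simp only [pow_one] at hH₁
  have hH₂ := hH 2
  refine ⟨⟨(h.integrable_risk_avgIterate hη hb ht).sub (integrable_const _), ?_⟩,
    ⟨(h.integrable_risk_iterate hη hb ht).sub (integrable_const _), ?_⟩⟩
  · refine (h.integral_risk_avgIterate_sub_le hη hb happ ht).trans ?_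
    rw [← hA, ← hG, mul_add, mul_add]
    gcongr
  · rw [integral_sub (h.integrable_risk_iterate hη hb ht) (integrable_const _), integral_const,
      probReal_univ, one_smul]
    change SGM.meanRisk ρ V Φ η m t - _ ≤ _
    rcases ht.eq_or_lt with rfl | ht2
    -- The first iterate is `0`, so its excess risk is at most `V₀`.
    · have e : SGM.meanRisk ρ V Φ η m 1 = SGM.risk ρ V Φ (0 : F) := by
        have h0 (z : Fin m → X × Y) (j : ℕ → Fin m) : SGM.iterate V Φ η z j 1 = 0 := rfl
        simp [SGM.meanRisk, h0]
      have h1 : SGM.risk ρ V Φ (0 : F) ≤ V₀ := by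
        simpa using (le_abs_self _).trans (h.abs_risk_le (ρ := ρ) (0 : F))
      have h2 := h.infRisk_nonneg (ρ := ρ)
      have h3 := SGM.one_le_add_rpow_div hηt hβ.le
      have h4 := mul_le_mul_of_nonneg_left h3 hC0
      simp only [Finset.Ico_self, Finset.sum_empty, mul_zero, zero_add, Finset.Icc_self,
        Finset.sum_singleton, Nat.cast_one, mul_one]
      linarith
    · refine (h.meanRisk_sub_infRisk_le hη hb hanti happ ht2).trans ?_
      rw [← hA, ← hG, mul_add, mul_add, mul_add]
      gcongr
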